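/- Let $N\ge 1$, let $\Omega\subset\mathbb R^N$ be a bounded open set, let $A\in L^\infty(\Omega)^{N\times N}$ (not necessarily symmetric) satisfy $A(x)\ge \alpha I$ for a.e. $x\in\Omega$, for some $\alpha>0$, and let $F:\Omega\times[0,+\infty[\to[0,+\infty]$ be a Carathéodory function, i.e. $s\mapsto F(x,s)\in[0,+\infty]$ is continuous for a.e. $x\in\Omega$ and $x\mapsto F(x,s)$ is measurable for every $s\ge 0$. Assume that there are $0<\gamma\le 1$ and $h\in L^r(\Omega)$, $h\ge 0$ a.e., with $r=\frac{2N}{N+2}$ if $N\ge 3$, some $r>1$ if $N=2$, and $r=1$ if $N=1$, such that $$0\le F(x,s)\le h(x)\Big(\frac1{s^\gamma}+1\Big)\quad\text{for a.e. }x\in\Omega,\ \forall s>0.$$ Let $\lambda_1$ be the first (smallest) eigenvalue of the operator $-\mathrm{div}\,{}^s\!A(x)D$ in $H^1_0(\Omega)$, where ${}^s\!A=(A+{}^t\!A)/2$, and assume that for some $\lambda$ with $0\le\lambda<\lambda_1$ $$F(x,s)-\lambda s\le F(x,t)-\lambda t\quad\text{for a.e. }x\in\Omega,\ \forall s,t \text{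 with } 0\le t\le s.$$ A function $u$ is called a solution of the problem $-\mathrm{div}\,A(x)Du=F(x,u)$ in $\Omega$, $u=0$ on $\partial\Omega$, if $u\in H^1_0(\Omega)$, $u\ge 0$ a.e. in $\Omega$, and for every $\varphi\in H^1_0(\Omega)$ with $\varphi\ge 0$ one has $$\int_\Omega F(x,u)\varphi<+\infty\quad\text{and}\quad\int_\Omega A(x)Du\,D\varphi=\int_\Omega F(x,u)\varphi .$$ Then the solution is unique: if $u_1$ and $u_2$ are two solutions of this problem, then $u_1=u_2$ a.e. in $\Omega$. -/

import Mathlib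

open MeasureTheory Filter Topology Set
open scoped ENNReal Matrix ContDiff

namespace SingularDirichlet

variable {N : ℕ}

/-- The Lebesgue measure on `Ω`. -/
noncomputable abbrev vol (Ω : Set (EuclideanSpace ℝ (Fin N))) :
    Measure (EuclideanSpace ℝ (Fin N)) :=
  volume.restrict Ω

/-- `φ ∈ 𝒟(Ω)`: smooth, with compact support included in `Ω`. -/
structure IsTestFunction (Ω : Set (EuclideanSpace ℝ (Fin N)))
    (φ : EuclideanSpace ℝ (Fin N) → ℝ) : Prop where
  smooth : ContDiff ℝ ∞ φ
  compact : HasCompactSupport φ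
  support_subset : tsupport φ ⊆ Ω

/-- `w ∈ H¹(Ω)` and `Dw = G`: both are square integrable on `Ω`, and `G` is the gradient of `w`
in the sense of distributions on `Ω`. -/
structure MemH1 (Ω : Set (EuclideanSpace ℝ (Fin N)))
    (w : EuclideanSpace ℝ (Fin N) → ℝ)
    (G : EuclideanSpace ℝ (Fin N) → EuclideanSpace ℝ (Fin N)) : Prop where
  memLp : MemLp w 2 (vol Ω)
  memLp_grad : MemLp G 2 (vol Ω)
  weak_grad : ∀ φ : EuclideanSpace ℝ (Fin N) → ℝ, IsTestFunction Ω φ →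
    ∫ x in Ω, w x • gradient φ x = - ∫ x in Ω, φ x • G x

/-- `w ∈ H¹₀(Ω)` and `Dw = G`: an element of `H¹(Ω)` which is the limit, in the norm of `H¹(Ω)`,
of a sequence of functions of `𝒟(Ω)`. -/
structure MemH10 (Ω : Set (EuclideanSpace ℝ (Fin N)))
    (w : EuclideanSpace ℝ (Fin N) → ℝ)
    (G : EuclideanSpace ℝ (Fin N) → EuclideanSpace ℝ (Fin N)) : Prop where
  memH1 : MemH1 Ω w G
  approx : ∃ φ : ℕ → EuclideanSpace ℝ (Fin N) → ℝ,
    (∀ n, IsTestFunction Ω (φ n)) ∧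
    Tendsto (fun n => eLpNorm (fun x => φ n x - w x) 2 (vol Ω)) atTop (𝓝 0) ∧
    Tendsto (fun n => eLpNorm (fun x => gradient (φ n) x - G x) 2 (vol Ω)) atTop (𝓝 0)

/-- `∫_Ω A(x) G(x) · Φ(x) dx`. -/
noncomputable def energy (Ω : Set (EuclideanSpace ℝ (Fin N)))
    (A : EuclideanSpace ℝ (Fin N) → Matrix (Fin N) (Fin N) ℝ)
    (G Φ : EuclideanSpace ℝ (Fin N) → EuclideanSpace ℝ (Fin N)) : ℝ :=
  ∫ x in Ω, (Φ x).ofLp ⬝ᵥ (A x *ᵥ (G x).ofLp)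

/-- `A ∈ L^∞(Ω)^{N×N}`, and there is `α > 0` with `A(x) ≥ α I` for a.e. `x ∈ Ω`.
The matrix `A(x)` need not be symmetric. -/
structure BoundedCoercive (Ω : Set (EuclideanSpace ℝ (Fin N)))
    (A : EuclideanSpace ℝ (Fin N) → Matrix (Fin N) (Fin N) ℝ) : Prop where
  bounded : ∀ i j, MemLp (fun x => A x i j) ⊤ (vol Ω)
  coercive : ∃ α : ℝ, 0 < α ∧ ∀ᵐ x ∂(vol Ω), ∀ ξ : EuclideanSpace ℝ (Fin N),
    α * ‖ξ‖ ^ 2 ≤ ξ.ofLp ⬝ᵥ (A x *ᵥ ξ.ofLp)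

/-- `F : Ω × [0,+∞[ → [0,+∞]` is a Carathéodory function. The values `F x s` with `s < 0` are
irrelevant; `AEMeasurable` is measurability with respect to Lebesgue measurable sets. -/
structure IsCaratheodory (Ω : Set (EuclideanSpace ℝ (Fin N)))
    (F : EuclideanSpace ℝ (Fin N) → ℝ → ℝ≥0∞) : Prop where
  continuous : ∀ᵐ x ∂(vol Ω), ContinuousOn (F x) (Ici 0)
  measurable : ∀ s : ℝ, 0 ≤ s → AEMeasurable (fun x => F x s) (vol Ω)

/-- `r = 1` if `N = 1`, `r > 1` if `N = 2`, `r = 2N/(N+2)` if `N ≥ 3`. -/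
def AdmissibleExponent (N : ℕ) (r : ℝ≥0∞) : Prop :=
  (N = 1 → r = 1) ∧ (N = 2 → 1 < r) ∧
    (3 ≤ N → r = ENNReal.ofReal (2 * (N : ℝ) / ((N : ℝ) + 2)))

/-- `0 ≤ F(x,s) ≤ h(x) (1/s^γ + 1)` for a.e. `x ∈ Ω` and all `s > 0`, for some `0 < γ ≤ 1` and some
nonnegative `h ∈ L^r(Ω)`. -/
def SingularGrowth (Ω : Set (EuclideanSpace ℝ (Fin N)))
    (F : EuclideanSpace ℝ (Fin N) → ℝ → ℝ≥0∞) : Prop :=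
  ∃ (γ : ℝ) (h : EuclideanSpace ℝ (Fin N) → ℝ) (r : ℝ≥0∞),
    0 < γ ∧ γ ≤ 1 ∧ AdmissibleExponent N r ∧ MemLp h r (vol Ω) ∧
    (∀ᵐ x ∂(vol Ω), 0 ≤ h x) ∧
    ∀ᵐ x ∂(vol Ω), ∀ s : ℝ, 0 < s → F x s ≤ ENNReal.ofReal (h x * (1 / s ^ γ + 1))

/-- The symmetrized part `(A(x) + ᵗA(x)) / 2`. -/
noncomputable def symmPart (A : EuclideanSpace ℝ (Fin N) → Matrix (Fin N) (Fin N) ℝ) :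
    EuclideanSpace ℝ (Fin N) → Matrix (Fin N) (Fin N) ℝ :=
  fun x => (1 / 2 : ℝ) • (A x + (A x)ᵀ)

/-- `μ` is an eigenvalue of `-div B(x) D` in `H¹₀(Ω)`: there is a nonzero `w ∈ H¹₀(Ω)` with
`-div B(x) Dw = μ w`, in the weak form. -/
def IsDirichletEigenvalue (Ω : Set (EuclideanSpace ℝ (Fin N)))
    (B : EuclideanSpace ℝ (Fin N) → Matrix (Fin N) (Fin N) ℝ) (μ : ℝ) : Prop :=
  ∃ (w : EuclideanSpace ℝ (Fin N) → ℝ)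
    (Dw : EuclideanSpace ℝ (Fin N) → EuclideanSpace ℝ (Fin N)),
    MemH10 Ω w Dw ∧ ¬ (w =ᵐ[vol Ω] 0) ∧
    ∀ (φ : EuclideanSpace ℝ (Fin N) → ℝ)
      (Dφ : EuclideanSpace ℝ (Fin N) → EuclideanSpace ℝ (Fin N)),
      MemH10 Ω φ Dφ → energy Ω B Dw Dφ = μ * ∫ x in Ω, w x * φ x

/-- The first (lowest) eigenvalue of `-div B(x) D` in `H¹₀(Ω)`. It is `+∞` if there are no
eigenvalues at all, which is the case of the empty set `Ω`. -/
noncomputable def firstEigenvalue (Ω : Set (EuclideanSpace ℝ (Fin N)))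
    (B : EuclideanSpace ℝ (Fin N) → Matrix (Fin N) (Fin N) ℝ) : EReal :=
  sInf {e : EReal | ∃ μ : ℝ, IsDirichletEigenvalue Ω B μ ∧ e = (μ : EReal)}

/-- `F(x,s) - λ s ≤ F(x,t) - λ t` in `]-∞,+∞]` for a.e. `x ∈ Ω` and all `0 ≤ t ≤ s`, for some
`0 ≤ λ < λ₁`, where `λ₁` is the first eigenvalue for the symmetrized part of `A`. -/
def AlmostNonincreasing (Ω : Set (EuclideanSpace ℝ (Fin N)))
    (A : EuclideanSpace ℝ (Fin N) → Matrix (Fin N) (Fin N) ℝ)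
    (F : EuclideanSpace ℝ (Fin N) → ℝ → ℝ≥0∞) : Prop :=
  ∃ lam : ℝ, 0 ≤ lam ∧ (lam : EReal) < firstEigenvalue Ω (symmPart A) ∧
    ∀ᵐ x ∂(vol Ω), ∀ s t : ℝ, 0 ≤ t → t ≤ s →
      (F x s : EReal) - ((lam * s : ℝ) : EReal) ≤ (F x t : EReal) - ((lam * t : ℝ) : EReal)

/-- `u` is a solution of `-div A(x) Du = F(x,u)` in `Ω`, `u = 0` on `∂Ω`: `u ∈ H¹₀(Ω)`, `u ≥ 0`, and
for every nonnegative `φ ∈ H¹₀(Ω)` the integral `∫_Ω F(x,u) φ`, which is defined in `[0,+∞]`, is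
finite and equal to `∫_Ω A(x) Du Dφ`. -/
def IsSolution (Ω : Set (EuclideanSpace ℝ (Fin N)))
    (A : EuclideanSpace ℝ (Fin N) → Matrix (Fin N) (Fin N) ℝ)
    (F : EuclideanSpace ℝ (Fin N) → ℝ → ℝ≥0∞)
    (u : EuclideanSpace ℝ (Fin N) → ℝ) : Prop :=
  ∃ Du : EuclideanSpace ℝ (Fin N) → EuclideanSpace ℝ (Fin N),
    MemH10 Ω u Du ∧ (∀ᵐ x ∂(vol Ω), 0 ≤ u x) ∧
    ∀ (φ : EuclideanSpace ℝ (Fin N) → ℝ)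
      (Dφ : EuclideanSpace ℝ (Fin N) → EuclideanSpace ℝ (Fin N)),
      MemH10 Ω φ Dφ → (∀ᵐ x ∂(vol Ω), 0 ≤ φ x) →
        ∫⁻ x in Ω, F x (u x) * ENNReal.ofReal (φ x) < ⊤ ∧
        energy Ω A Du Dφ = (∫⁻ x in Ω, F x (u x) * ENNReal.ofReal (φ x)).toReal

end SingularDirichlet

/-! Test both equations with w = (u₁ - u₂)⁺ and subtract. The left side becomes ∫ A Dw·Dw, because
Dw equals D(u₁ - u₂) on {u₁ > u₂} and vanishes elsewhere; the one-sided bound on F makes the right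
side at most λ ∫ w². A nonzero w would thus have a Rayleigh quotient at most λ < λ₁. Only the
symmetric part of A enters ∫ A Dw·Dw, so this contradicts the variational characterization of λ₁.
Hence u₁ ≤ u₂ (`IsSolution.ae_le`), and exchanging the roles gives equality.

Since λ₁ is defined as an infimum of eigenvalues, that characterization has to be proved: the
Rayleigh quotient attains its minimum, and the minimum is an eigenvalue
(`exists_rayleigh_minimizer`, `exists_eigenvalue_le_of_energy_le`). The compactness needed is
Rellich's theorem (`isCompactOperator_sobolevZeroFst`): the embedding is a norm limit of finite rank
operators, built from the projections onto step functions on finer and finer grids. That w is an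
admissible test function is `MemH10.posPart`, proved by smoothing the positive part. -/

namespace SingularDirichlet

/-! ### Minimizing a Rayleigh quotient. -/

section Rayleigh

variable {H K : Type*} [NormedAddCommGroup H] [NormedSpace ℝ H]
  [NormedAddCommGroup K] [InnerProductSpace ℝ K]

/-- A nonnegative symmetric bilinear form vanishes against its isotropic vectors. -/
theorem bilin_eq_zero_of_nonneg (D : H →ₗ[ℝ] H →ₗ[ℝ] ℝ) (hsymm : ∀ u v, D u v = D v u)
    (hnonneg : ∀ u, 0 ≤ D u u) {u : H} (hu : D u u = 0) (v : H) : D u v = 0 := by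
  by_contra hne
  have hq := hnonneg v
  have key : ∀ t : ℝ, 0 ≤ 2 * t * D u v + t ^ 2 * D v v := by
    intro t
    have h := hnonneg (u + t • v)
    simp only [map_add, map_smul, LinearMap.add_apply, LinearMap.smul_apply,
      smul_eq_mul, hu, hsymm v u] at h
    linarith
  -- Nearly the minimizer of the quadratic in t; the `+ 1` keeps the denominator positive when `D v
  -- v = 0`, and the value is still negative.
  have h1 := key (-(D u v) / (D v v + 1))
  have h2 : 2 * (-(D u v) / (D v v + 1)) * D u v + (-(D u v) / (D v v + 1)) ^ 2 * D v v
      = -((D u v) ^ 2 * (D v v + 2) / (D v v + 1) ^ 2) := by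
    field_simp
    ring
  rw [h2] at h1
  have : 0 < (D u v) ^ 2 * (D v v + 2) / (D v v + 1) ^ 2 := by positivity
  linarith

/-- A bounded symmetric coercive form attains its minimal Rayleigh quotient with respect to a
compact operator, at a vector satisfying the eigenvalue equation. -/
theorem exists_rayleigh_minimizer [CompleteSpace H] (ι : H →L[ℝ] K) (hι : IsCompactOperator ι)
    (B : H →L[ℝ] H →L[ℝ] ℝ) (hsymm : ∀ u v, B u v = B v u) {c : ℝ} (hc : 0 < c)
    (hcoer : ∀ u, c * ‖u‖ ^ 2 ≤ B u u) (w : H) (hw : ι w ≠ 0) :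
    ∃ (u : H) (m : ℝ), ι u ≠ 0 ∧ m * ‖ι w‖ ^ 2 ≤ B w w ∧ ∀ v, B u v = m * inner ℝ (ι u) (ι v) := by
  have hB0 : ∀ u, 0 ≤ B u u := fun u => (by positivity : 0 ≤ c * ‖u‖ ^ 2).trans (hcoer u)
  set S : Set ℝ := (fun u => B u u) '' {u | ‖ι u‖ = 1} with hS
  have hbdd : BddBelow S := ⟨0, by rintro _ ⟨u, -, rfl⟩; exact hB0 u⟩
  have hnorm : ∀ u, ι u ≠ 0 → ‖ι (‖ι u‖⁻¹ • u)‖ = 1 := by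
    intro u hu
    rw [map_smul, norm_smul, norm_inv, norm_norm, inv_mul_cancel₀ (norm_ne_zero_iff.2 hu)]
  have hne : S.Nonempty := ⟨_, _, hnorm w hw, rfl⟩
  set m := sInf S with hm
  have hmin : ∀ u, m * ‖ι u‖ ^ 2 ≤ B u u := by
    intro u
    by_cases hu : ι u = 0
    · simpa [hu] using hB0 u
    · have h := csInf_le hbdd ⟨_, hnorm u hu, rfl⟩
      simp only [map_smul, smul_apply, smul_eq_mul] at h
      have hp : 0 < ‖ι u‖ := norm_pos_iff.2 hu
      calc m * ‖ι u‖ ^ 2 ≤ ‖ι u‖⁻¹ * (‖ι u‖⁻¹ * B u u) * ‖ι u‖ ^ 2 := by gcongr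
        _ = B u u := by field_simp
  have hm0 : 0 ≤ m := le_csInf hne (by rintro _ ⟨u, -, rfl⟩; exact hB0 u)
  obtain ⟨b, -, hb, hbS⟩ := exists_seq_tendsto_sInf hne hbdd
  rw [← hm] at hb
  choose u hu1 hub using hbS
  have hu1' : ∀ n, ‖ι (u n)‖ = 1 := hu1
  obtain ⟨R, hR⟩ := hb.bddAbove_range
  have hubd : ∀ n, u n ∈ Metric.closedBall (0 : H) (√(R / c)) := by
    intro n
    rw [mem_closedBall_zero_iff]
    apply Real.le_sqrt_of_sq_le
    rw [le_div_iff₀ hc, mul_comm]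
    calc c * ‖u n‖ ^ 2 ≤ B (u n) (u n) := hcoer _
      _ = b n := hub n
      _ ≤ R := hR ⟨n, rfl⟩
  obtain ⟨k, -, φ, hφ, hk⟩ := (hι.isCompact_closure_image_closedBall (√(R / c))).tendsto_subseq
    (x := fun n => ι (u n)) (fun n => subset_closure ⟨_, hubd n, rfl⟩)
  -- Parallelogram identities for `B` and for the norm of `K`, with `m` bounding `B` below at `u i +
  -- u j`. Convergence of the images under `ι` thus forces the minimizing sequence to be Cauchy in
  -- `H` itself, without weak compactness.
  have hpar : ∀ i j, c * ‖u i - u j‖ ^ 2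
      ≤ 2 * (b i - m) + 2 * (b j - m) + m * ‖ι (u i) - ι (u j)‖ ^ 2 := by
    intro i j
    have h1 := hcoer (u i - u j)
    have h2 := hmin (u i + u j)
    have h3 := parallelogram_law_with_norm ℝ (ι (u i)) (ι (u j))
    rw [hu1', hu1'] at h3
    simp only [map_add, map_sub, add_apply, sub_apply]
      at h1 h2
    have e1 := hub i
    have e2 := hub j
    simp only at e1 e2
    have h4 : ‖ι (u i) + ι (u j)‖ ^ 2 = 4 - ‖ι (u i) - ι (u j)‖ ^ 2 := by nlinarith
    rw [h4] at h2
    nlinarith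
  have hcau : CauchySeq (fun n => u (φ n)) := by
    rw [cauchySeq_iff_tendsto_dist_atTop_0]
    have hφt := hφ.tendsto_atTop
    have hb' : Tendsto (fun n => 2 * (b (φ n) - m)) atTop (𝓝 0) := by
      have := ((hb.comp hφt).sub_const m).const_mul 2
      simpa [sub_self, Function.comp_def] using this
    have hk' : Tendsto (fun p : ℕ × ℕ => ‖ι (u (φ p.1)) - ι (u (φ p.2))‖) atTop (𝓝 0) := by
      have := cauchySeq_iff_tendsto_dist_atTop_0.1 hk.cauchySeq
      simpa [dist_eq_norm, Function.comp_def] using this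
    rw [← prod_atTop_atTop_eq] at hk' ⊢
    have htot : Tendsto (fun p : ℕ × ℕ => (2 * (b (φ p.1) - m) + 2 * (b (φ p.2) - m)
        + m * ‖ι (u (φ p.1)) - ι (u (φ p.2))‖ ^ 2) / c) (atTop ×ˢ atTop) (𝓝 0) := by
      have := (((hb'.comp tendsto_fst).add (hb'.comp tendsto_snd)).add
        ((hk'.pow 2).const_mul m)).div_const c
      simpa [Function.comp_def] using this
    have hs := (Real.continuous_sqrt.tendsto 0).comp htot
    rw [Real.sqrt_zero] at hs
    refine squeeze_zero (fun _ => dist_nonneg) (fun p => ?_) hs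
    rw [dist_eq_norm]
    apply Real.le_sqrt_of_sq_le
    rw [le_div_iff₀ hc, mul_comm]
    exact hpar _ _
  obtain ⟨v, hv⟩ := cauchySeq_tendsto_of_complete hcau
  have hιv : ‖ι v‖ = 1 := by
    have h := ((ι.continuous.tendsto v).comp hv).norm
    simp only [Function.comp_def, hu1'] at h
    exact tendsto_nhds_unique h tendsto_const_nhds
  have hBv : B v v = m := by
    have h1 : Continuous fun z : H => B z z := by fun_prop
    have h := (h1.tendsto v).comp hv
    refine tendsto_nhds_unique h ?_
    refine (hb.comp hφ.tendsto_atTop).congr fun n => ?_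
    exact (hub (φ n)).symm
  -- `D` is nonnegative and isotropic at the minimizer, so `bilin_eq_zero_of_nonneg` yields the
  -- Euler-Lagrange equation.
  set D : H →ₗ[ℝ] H →ₗ[ℝ] ℝ := B.toLinearMap₁₂ - m • ((innerₗ K).compl₁₂ ι.toLinearMap ι.toLinearMap)
    with hD
  have hDa : ∀ x y, D x y = B x y - m * inner ℝ (ι x) (ι y) := by
    intro x y
    simp [hD]
  refine ⟨v, m, fun h => ?_, hmin w, fun x => ?_⟩
  · rw [h, norm_zero] at hιv
    exact zero_ne_one hιv
  · have h := bilin_eq_zero_of_nonneg D (fun x y => by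
        rw [hDa, hDa, hsymm, real_inner_comm]) (fun x => by
        rw [hDa, real_inner_self_eq_norm_sq]
        exact sub_nonneg.2 (hmin x)) (u := v) (by
        rw [hDa, real_inner_self_eq_norm_sq, hBv, hιv]; ring) x
    rw [hDa] at h
    linarith

end Rayleigh

/-! ### L² estimates for translations. -/

section Translation

/-- The `L²` norm of a difference quotient is at most that of the derivative. -/
theorem enorm_sub_sq_le_lintegral_fderiv {E : Type*} [NormedAddCommGroup E] [NormedSpace ℝ E]
    {φ : E → ℝ} (hφ : ContDiff ℝ 1 φ) (x z : E) :
    ‖φ (x + z) - φ x‖ₑ ^ 2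
      ≤ ‖z‖ₑ ^ 2 * ∫⁻ t in Ioc (0 : ℝ) 1, ‖fderiv ℝ φ (x + t • z)‖ₑ ^ 2 := by
  have hcont : Continuous fun t : ℝ => fderiv ℝ φ (x + t • z) :=
    (hφ.continuous_fderiv one_ne_zero).comp (by fun_prop)
  have hderiv : ∀ t : ℝ, HasDerivAt (fun t : ℝ => φ (x + t • z)) (fderiv ℝ φ (x + t • z) z) t := by
    intro t
    have h1 : HasDerivAt (fun t : ℝ => x + t • z) z t := by
      simpa using ((hasDerivAt_id t).smul_const z).const_add x
    exact ((hφ.differentiable one_ne_zero) (x + t • z)).hasFDerivAt.comp_hasDerivAt t h1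
  have hcont' : Continuous fun t : ℝ => fderiv ℝ φ (x + t • z) z := hcont.clm_apply continuous_const
  have hftc : φ (x + z) - φ x = ∫ t in (0 : ℝ)..1, fderiv ℝ φ (x + t • z) z := by
    rw [intervalIntegral.integral_eq_sub_of_hasDerivAt (fun t _ => hderiv t)
      (hcont'.intervalIntegrable _ _)]
    simp
  have h1 : ‖φ (x + z) - φ x‖ₑ ≤ ∫⁻ t in Ioc (0 : ℝ) 1, ‖z‖ₑ * ‖fderiv ℝ φ (x + t • z)‖ₑ := by
    rw [hftc, intervalIntegral.integral_of_le zero_le_one]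
    refine (enorm_integral_le_lintegral_enorm _).trans (lintegral_mono fun t => ?_)
    rw [mul_comm]
    exact ContinuousLinearMap.le_opENorm _ _
  have hm : Measurable fun t : ℝ => ‖fderiv ℝ φ (x + t • z)‖ₑ := hcont.enorm.measurable
  -- Cauchy-Schwarz against the constant 1 on an interval of length 1, so no extra constant appears.
  have h2 := ENNReal.lintegral_mul_le_Lp_mul_Lq (volume.restrict (Ioc (0 : ℝ) 1))
    Real.HolderConjugate.two_two hm.aemeasurable (g := fun _ => 1) aemeasurable_const
  simp only [Pi.mul_apply, mul_one, ENNReal.one_rpow, lintegral_const, MeasurableSet.univ,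
    Measure.restrict_apply, univ_inter, Real.volume_Ioc, sub_zero, ENNReal.ofReal_one] at h2
  rw [lintegral_const_mul _ hm] at h1
  calc ‖φ (x + z) - φ x‖ₑ ^ 2
      ≤ (‖z‖ₑ * (∫⁻ t in Ioc (0 : ℝ) 1, ‖fderiv ℝ φ (x + t • z)‖ₑ ^ (2 : ℝ)) ^ (1 / 2 : ℝ)) ^ 2 := by
        gcongr
        exact h1.trans (by gcongr)
    _ = _ := by
        rw [mul_pow, ← ENNReal.rpow_natCast (_ ^ (1 / 2 : ℝ)), ← ENNReal.rpow_mul]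
        norm_num

/-- Integrate the bound along segments and apply Tonelli: by translation invariance every t
contributes the same integral. -/
theorem lintegral_translate_sub_sq_le {E : Type*} [NormedAddCommGroup E] [NormedSpace ℝ E]
    [FiniteDimensional ℝ E] [MeasurableSpace E] [BorelSpace E] (μ : Measure E)
    [μ.IsAddHaarMeasure] {φ : E → ℝ} (hφ : ContDiff ℝ 1 φ) (z : E) :
    ∫⁻ x, ‖φ (x + z) - φ x‖ₑ ^ 2 ∂μ ≤ ‖z‖ₑ ^ 2 * ∫⁻ x, ‖fderiv ℝ φ x‖ₑ ^ 2 ∂μ := by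
  have hm : Measurable (Function.uncurry fun (x : E) (t : ℝ) => ‖fderiv ℝ φ (x + t • z)‖ₑ ^ 2) := by
    have : Continuous (Function.uncurry fun (x : E) (t : ℝ) => fderiv ℝ φ (x + t • z)) :=
      (hφ.continuous_fderiv one_ne_zero).comp (by fun_prop)
    exact (this.enorm.measurable).pow_const 2
  calc ∫⁻ x, ‖φ (x + z) - φ x‖ₑ ^ 2 ∂μ
      ≤ ∫⁻ x, (‖z‖ₑ ^ 2 * ∫⁻ t in Ioc (0 : ℝ) 1, ‖fderiv ℝ φ (x + t • z)‖ₑ ^ 2) ∂μ :=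
        lintegral_mono fun x => enorm_sub_sq_le_lintegral_fderiv hφ x z
    _ = ‖z‖ₑ ^ 2 * ∫⁻ x, (∫⁻ t in Ioc (0 : ℝ) 1, ‖fderiv ℝ φ (x + t • z)‖ₑ ^ 2) ∂μ :=
        lintegral_const_mul' _ _ (by simp)
    _ = ‖z‖ₑ ^ 2 * ∫⁻ t in Ioc (0 : ℝ) 1, ∫⁻ x, ‖fderiv ℝ φ (x + t • z)‖ₑ ^ 2 ∂μ := by
        rw [lintegral_lintegral_swap hm.aemeasurable]
    _ = ‖z‖ₑ ^ 2 * ∫⁻ t in Ioc (0 : ℝ) 1, ∫⁻ x, ‖fderiv ℝ φ x‖ₑ ^ 2 ∂μ := by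
        congr 1
        refine lintegral_congr fun t => ?_
        exact lintegral_add_right_eq_self (fun y => ‖fderiv ℝ φ y‖ₑ ^ 2) _
    _ = ‖z‖ₑ ^ 2 * ∫⁻ x, ‖fderiv ℝ φ x‖ₑ ^ 2 ∂μ := by simp

end Translation

/-! ### Approximation by step functions on a grid. -/

section Grid

variable {N : ℕ}

/-- The multi-index of the cell of the grid of mesh `h` which contains `x`. -/
noncomputable def cell (h : ℝ) (x : EuclideanSpace ℝ (Fin N)) : Fin N → ℤ := fun i => ⌊x i / h⌋

/-- The lower corner of the cell of multi-index `k`. -/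
noncomputable def cellCorner (h : ℝ) (k : Fin N → ℤ) : EuclideanSpace ℝ (Fin N) :=
  WithLp.toLp 2 fun i => h * k i

theorem measurable_cell (h : ℝ) : Measurable (cell (N := N) h) := by
  unfold cell
  refine measurable_pi_lambda _ fun i => Int.measurable_floor.comp ?_
  exact ((EuclideanSpace.proj (𝕜 := ℝ) i).continuous.measurable).div_const h

theorem measurable_cellCorner (h : ℝ) : Measurable (cellCorner (N := N) h) :=
  measurable_of_countable _

theorem volume_box (a b : ℝ) :
    volume {y : EuclideanSpace ℝ (Fin N) | ∀ i, y i ∈ Ioo a b} = ENNReal.ofReal (b - a) ^ N := by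
  have h := (PiLp.volume_preserving_ofLp (Fin N)).measure_preimage
    (s := pi univ fun _ => Ioo a b)
    (MeasurableSet.univ_pi fun _ => measurableSet_Ioo).nullMeasurableSet
  rw [Real.volume_pi_Ioo] at h
  simpa [preimage, Set.mem_pi] using h

theorem measurableSet_box (a b : ℝ) :
    MeasurableSet {y : EuclideanSpace ℝ (Fin N) | ∀ i, y i ∈ Ioo a b} := by
  have h := (PiLp.volume_preserving_ofLp (Fin N)).measurable
    (MeasurableSet.univ_pi (t := fun _ => Ioo a b) fun _ => measurableSet_Ioo)
  simpa [preimage, Set.mem_pi] using h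

theorem enorm_sq_le_of_mem_box {h : ℝ} {z : EuclideanSpace ℝ (Fin N)}
    (hz : ∀ i, z i ∈ Ioo (-h) h) : ‖z‖ₑ ^ 2 ≤ ENNReal.ofReal (N * h ^ 2) := by
  rw [← ofReal_norm, ← ENNReal.ofReal_pow (norm_nonneg _)]
  apply ENNReal.ofReal_le_ofReal
  rw [EuclideanSpace.norm_sq_eq]
  calc ∑ i, ‖z i‖ ^ 2 ≤ ∑ _i : Fin N, h ^ 2 := by
        gcongr with i
        rw [Real.norm_eq_abs]
        exact (abs_lt.2 ⟨(hz i).1, (hz i).2⟩).le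
    _ = N * h ^ 2 := by simp

/-- A smooth function is close in `L²` to one of the step functions that sample it once in each
cell of the grid of mesh `h`, at the same relative position. -/
theorem exists_sample_lintegral_sub_sq_le {h : ℝ} (hh : 0 < h)
    {φ : EuclideanSpace ℝ (Fin N) → ℝ} (hφ : ContDiff ℝ 1 φ) :
    ∃ y, ∫⁻ x, ‖φ (cellCorner h (cell h x) + y) - φ x‖ₑ ^ 2
      ≤ ENNReal.ofReal (2 ^ N * N * h ^ 2) * ∫⁻ x, ‖fderiv ℝ φ x‖ₑ ^ 2 := by
  set Q := {y : EuclideanSpace ℝ (Fin N) | ∀ i, y i ∈ Ioo 0 h} with hQ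
  set D := {y : EuclideanSpace ℝ (Fin N) | ∀ i, y i ∈ Ioo (-h) h} with hD
  set c : EuclideanSpace ℝ (Fin N) → EuclideanSpace ℝ (Fin N) := fun x => cellCorner h (cell h x)
    with hc
  have hcm : Measurable c := (measurable_cellCorner h).comp (measurable_cell h)
  have hφm : Measurable φ := hφ.continuous.measurable
  have hQ0 : volume Q ≠ 0 := by
    rw [hQ, volume_box]
    simp [hh]
  have hQt : volume Q ≠ ⊤ := by
    rw [hQ, volume_box]
    simp
  -- Source of the factor `2 ^ N`: displacements fill the box of side 2h, while the average is over
  -- a cell of side h.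
  have hDQ : volume D = 2 ^ N * volume Q := by
    rw [hD, hQ, volume_box, volume_box, ← mul_pow, sub_zero, sub_neg_eq_add, ← two_mul,
      ENNReal.ofReal_mul zero_le_two]
    simp
  have hm : Measurable (Function.uncurry fun (y x : EuclideanSpace ℝ (Fin N)) =>
      ‖φ (c x + y) - φ x‖ₑ ^ 2) := by
    have h1 : Measurable fun p : EuclideanSpace ℝ (Fin N) × EuclideanSpace ℝ (Fin N) =>
        φ (c p.2 + p.1) - φ p.2 :=
      (hφm.comp ((hcm.comp measurable_snd).add measurable_fst)).sub (hφm.comp measurable_snd)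
    exact h1.enorm.pow_const 2
  have hm' : Measurable (Function.uncurry fun (x z : EuclideanSpace ℝ (Fin N)) =>
      ‖φ (x + z) - φ x‖ₑ ^ 2) := by
    have h1 : Measurable fun p : EuclideanSpace ℝ (Fin N) × EuclideanSpace ℝ (Fin N) =>
        φ (p.1 + p.2) - φ p.1 :=
      (hφm.comp (measurable_fst.add measurable_snd)).sub (hφm.comp measurable_fst)
    exact h1.enorm.pow_const 2
  have hcell : ∀ x i, (c x) i - x i ∈ Ioc (-h) 0 := by
    intro x i
    have h1 := Int.floor_le (x i / h)
    have h2 := Int.lt_floor_add_one (x i / h)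
    rw [le_div_iff₀ hh] at h1
    rw [div_lt_iff₀ hh] at h2
    have h3 : (c x) i = h * ⌊x i / h⌋ := rfl
    rw [h3]
    constructor <;> nlinarith
  -- Some sampling position does at least as well as the average over all of them, and the average
  -- reduces to translations.
  obtain ⟨y, -, hy⟩ := exists_le_setLAverage hQ0 hQt
    (f := fun y => ∫⁻ x, ‖φ (c x + y) - φ x‖ₑ ^ 2) hm.lintegral_prod_right'.aemeasurable
  refine ⟨y, hy.trans ?_⟩
  rw [setLAverage_eq]
  apply ENNReal.div_le_of_le_mul
  calc ∫⁻ y in Q, ∫⁻ x, ‖φ (c x + y) - φ x‖ₑ ^ 2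
      = ∫⁻ x, ∫⁻ y in Q, ‖φ (c x + y) - φ x‖ₑ ^ 2 := lintegral_lintegral_swap hm.aemeasurable
    _ ≤ ∫⁻ x, ∫⁻ z in D, ‖φ (x + z) - φ x‖ₑ ^ 2 := by
        refine lintegral_mono fun x => ?_
        -- Substitution `z = y + (c x - x)`: since `c x - x` has coordinates in ]-h, 0], it sends
        -- `Q` into `D`.
        have hs : ∫⁻ z in D, ‖φ (x + z) - φ x‖ₑ ^ 2
            = ∫⁻ y, D.indicator (fun z => ‖φ (x + z) - φ x‖ₑ ^ 2) (y + (c x - x)) := by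
          rw [lintegral_add_right_eq_self, lintegral_indicator (measurableSet_box _ _)]
        dsimp only
        rw [hs, ← lintegral_indicator (measurableSet_box _ _)]
        refine lintegral_mono fun y => ?_
        by_cases hy : y ∈ Q
        · have hy' : y + (c x - x) ∈ D := by
            intro i
            have h1 := hcell x i
            have h2 := hy i
            have h3 : (y + (c x - x)) i = y i + ((c x) i - x i) := rfl
            rw [h3]
            constructor <;> linarith [h1.1, h1.2, h2.1, h2.2]
          rw [indicator_of_mem hy, indicator_of_mem hy']
          have : x + (y + (c x - x)) = c x + y := by abel
          rw [this]
        · rw [indicator_of_notMem hy]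
          exact zero_le
    _ = ∫⁻ z in D, ∫⁻ x, ‖φ (x + z) - φ x‖ₑ ^ 2 := lintegral_lintegral_swap hm'.aemeasurable
    _ ≤ ∫⁻ _z in D, ENNReal.ofReal (N * h ^ 2) * ∫⁻ x, ‖fderiv ℝ φ x‖ₑ ^ 2 := by
        refine setLIntegral_mono measurable_const fun z hz => ?_
        refine (lintegral_translate_sub_sq_le volume hφ z).trans ?_
        gcongr
        exact enorm_sq_le_of_mem_box hz
    _ = ENNReal.ofReal (2 ^ N * N * h ^ 2) * (∫⁻ x, ‖fderiv ℝ φ x‖ₑ ^ 2) * volume Q := by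
        rw [setLIntegral_const, hDQ, mul_assoc (2 ^ N : ℝ),
          ENNReal.ofReal_mul (p := 2 ^ N) (by positivity), ENNReal.ofReal_pow zero_le_two]
        simp only [ENNReal.ofReal_ofNat]
        ring

end Grid

/-! ### Test functions and integration by parts. -/

section TestFunctions

variable {N : ℕ} {Ω : Set (EuclideanSpace ℝ (Fin N))}

theorem norm_gradient_eq (φ : EuclideanSpace ℝ (Fin N) → ℝ) (x : EuclideanSpace ℝ (Fin N)) :
    ‖gradient φ x‖ = ‖fderiv ℝ φ x‖ := by
  rw [← toDual_gradient (𝕜 := ℝ), LinearIsometryEquiv.norm_map]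

theorem inner_gradient_left' (φ : EuclideanSpace ℝ (Fin N) → ℝ) (x v : EuclideanSpace ℝ (Fin N)) :
    inner ℝ v (gradient φ x) = fderiv ℝ φ x v := by
  rw [real_inner_comm, inner_gradient_left]

namespace IsTestFunction

variable {φ ψ : EuclideanSpace ℝ (Fin N) → ℝ}

theorem differentiable (h : IsTestFunction Ω φ) : Differentiable ℝ φ :=
  h.smooth.differentiable (by simp)

theorem continuous_gradient (h : IsTestFunction Ω φ) : Continuous (gradient φ) := by
  unfold gradient
  exact (LinearIsometryEquiv.continuous _).comp (h.smooth.continuous_fderiv (by simp))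

theorem hasCompactSupport_gradient (h : IsTestFunction Ω φ) : HasCompactSupport (gradient φ) :=
  (h.compact.fderiv (𝕜 := ℝ)).comp_left (map_zero (InnerProductSpace.toDual ℝ _).symm)

theorem gradient_eq_zero_of_notMem (h : IsTestFunction Ω φ) {x} (hx : x ∉ Ω) :
    gradient φ x = 0 := by
  have h1 : fderiv ℝ φ x = 0 := by
    by_contra h2
    exact hx (h.support_subset (support_fderiv_subset ℝ h2))
  rw [← norm_eq_zero, norm_gradient_eq, h1, norm_zero]

theorem eq_zero_of_notMem (h : IsTestFunction Ω φ) {x} (hx : x ∉ Ω) : φ x = 0 :=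
  image_eq_zero_of_notMem_tsupport fun h1 => hx (h.support_subset h1)

theorem memLp (h : IsTestFunction Ω φ) {p : ℝ≥0∞} : MemLp φ p (vol Ω) :=
  h.smooth.continuous.memLp_of_hasCompactSupport h.compact

theorem memLp_gradient (h : IsTestFunction Ω φ) {p : ℝ≥0∞} : MemLp (gradient φ) p (vol Ω) :=
  h.continuous_gradient.memLp_of_hasCompactSupport h.hasCompactSupport_gradient

theorem zero : IsTestFunction Ω (0 : EuclideanSpace ℝ (Fin N) → ℝ) where
  smooth := contDiff_const
  compact := HasCompactSupport.zero
  support_subset := by simp [tsupport]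

theorem add (hφ : IsTestFunction Ω φ) (hψ : IsTestFunction Ω ψ) : IsTestFunction Ω (φ + ψ) where
  smooth := hφ.smooth.add hψ.smooth
  compact := hφ.compact.add hψ.compact
  support_subset := (tsupport_add φ ψ).trans (union_subset hφ.support_subset hψ.support_subset)

theorem const_smul (hφ : IsTestFunction Ω φ) (c : ℝ) : IsTestFunction Ω (c • φ) where
  smooth := contDiff_const.smul hφ.smooth
  compact := hφ.compact.smul_left
  support_subset := (tsupport_smul_subset_right (fun _ => c) φ).trans hφ.support_subset

theorem gradient_add (hφ : IsTestFunction Ω φ) (hψ : IsTestFunction Ω ψ) :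
    gradient (φ + ψ) = gradient φ + gradient ψ := by
  ext1 x
  simp only [gradient, Pi.add_apply]
  rw [fderiv_add (hφ.differentiable x) (hψ.differentiable x), map_add]

theorem gradient_const_smul (hφ : IsTestFunction Ω φ) (c : ℝ) :
    gradient (c • φ) = c • gradient φ := by
  ext1 x
  simp only [gradient, Pi.smul_apply]
  rw [fderiv_const_smul (hφ.differentiable x), map_smul]

/-- The supports lie in Ω, so both integrals extend to the whole space and no boundary term arises.
Pairing with a fixed vector reduces to the scalar formula. -/
theorem integral_smul_gradient (hφ : IsTestFunction Ω φ) (hψ : IsTestFunction Ω ψ) :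
    ∫ x in Ω, φ x • gradient ψ x = - ∫ x in Ω, ψ x • gradient φ x := by
  rw [setIntegral_eq_integral_of_forall_compl_eq_zero fun x hx => by
      rw [hφ.eq_zero_of_notMem hx, zero_smul],
    setIntegral_eq_integral_of_forall_compl_eq_zero fun x hx => by
      rw [hψ.eq_zero_of_notMem hx, zero_smul]]
  have hi : ∀ {f g : EuclideanSpace ℝ (Fin N) → ℝ}, IsTestFunction Ω f → IsTestFunction Ω g →
      Integrable (fun x => f x • gradient g x) := fun hf hg =>
    (hf.smooth.continuous.smul hg.continuous_gradient).integrable_of_hasCompactSupport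
      (hf.compact.smul_right)
  refine ext_inner_left ℝ fun v => ?_
  rw [inner_neg_right, ← integral_inner (hi hφ hψ), ← integral_inner (hi hψ hφ)]
  simp only [inner_smul_right, inner_gradient_left']
  have hi' : ∀ {f g : EuclideanSpace ℝ (Fin N) → ℝ}, IsTestFunction Ω f → IsTestFunction Ω g →
      Integrable (fun x => f x * fderiv ℝ g x v) := fun {f g} hf hg => by
    simpa only [inner_smul_right, inner_gradient_left'] using (hi hf hg).const_inner (𝕜 := ℝ) v
  rw [integral_mul_fderiv_eq_neg_fderiv_mul_of_integrable (by
    simpa only [mul_comm] using hi' hψ hφ) (hi' hφ hψ)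
    ((hφ.smooth.continuous.mul hψ.smooth.continuous).integrable_of_hasCompactSupport
      (hφ.compact.mul_right)) (fun x _ => hφ.differentiable x) (fun x _ => hψ.differentiable x)]
  simp only [mul_comm]

end IsTestFunction

/-- By Hölder, L² convergence times a fixed L² factor is L¹ convergence. -/
theorem tendsto_integral_smul_of_tendsto_eLpNorm {α F : Type*} [MeasurableSpace α] {μ : Measure α}
    [NormedAddCommGroup F] [NormedSpace ℝ F] {f : ℕ → α → ℝ} {f₀ : α → ℝ} {g : α → F}
    (hf : ∀ n, MemLp (f n) 2 μ) (hf₀ : MemLp f₀ 2 μ) (hg : MemLp g 2 μ)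
    (h : Tendsto (fun n => eLpNorm (fun x => f n x - f₀ x) 2 μ) atTop (𝓝 0)) :
    Tendsto (fun n => ∫ x, f n x • g x ∂μ) atTop (𝓝 (∫ x, f₀ x • g x ∂μ)) := by
  refine tendsto_integral_of_L1' _ (hf₀.1.smul hg.1)
    (Eventually.of_forall fun n => memLp_one_iff_integrable.1 (hg.smul (hf n))) ?_
  have h1 := ENNReal.Tendsto.mul_const h (b := eLpNorm g 2 μ) (Or.inr hg.eLpNorm_lt_top.ne)
  rw [zero_mul] at h1
  refine tendsto_of_tendsto_of_tendsto_of_le_of_le tendsto_const_nhds h1 (fun _ => zero_le)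
    fun n => ?_
  have h2 := eLpNorm_smul_le_mul_eLpNorm (r := 1) (p := 2) (q := 2) hg.1 ((hf n).sub hf₀).1
  refine le_trans (le_of_eq ?_) h2
  congr 1
  ext x
  simp [sub_smul]

theorem tendsto_integral_smul_of_tendsto_eLpNorm' {α F : Type*} [MeasurableSpace α] {μ : Measure α}
    [NormedAddCommGroup F] [NormedSpace ℝ F] {f : ℕ → α → F} {f₀ : α → F} {g : α → ℝ}
    (hf : ∀ n, MemLp (f n) 2 μ) (hf₀ : MemLp f₀ 2 μ) (hg : MemLp g 2 μ)
    (h : Tendsto (fun n => eLpNorm (fun x => f n x - f₀ x) 2 μ) atTop (𝓝 0)) :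
    Tendsto (fun n => ∫ x, g x • f n x ∂μ) atTop (𝓝 (∫ x, g x • f₀ x ∂μ)) := by
  refine tendsto_integral_of_L1' _ (hg.1.smul hf₀.1)
    (Eventually.of_forall fun n => memLp_one_iff_integrable.1 ((hf n).smul hg)) ?_
  have h1 := ENNReal.Tendsto.const_mul h (a := eLpNorm g 2 μ) (Or.inr hg.eLpNorm_lt_top.ne)
  rw [mul_zero] at h1
  refine tendsto_of_tendsto_of_tendsto_of_le_of_le tendsto_const_nhds h1 (fun _ => zero_le)
    fun n => ?_
  have h2 := eLpNorm_smul_le_mul_eLpNorm (r := 1) (p := 2) (q := 2) ((hf n).sub hf₀).1 hg.1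
  refine le_trans (le_of_eq ?_) h2
  congr 1
  ext x
  simp [smul_sub]

/-- The weak gradient identity comes for free: it holds for test functions and both sides pass to
the L² limit. Membership in H¹₀ reduces to finding an approximating sequence. -/
theorem memH10_of_approx {w : EuclideanSpace ℝ (Fin N) → ℝ}
    {G : EuclideanSpace ℝ (Fin N) → EuclideanSpace ℝ (Fin N)}
    (hw : MemLp w 2 (vol Ω)) (hG : MemLp G 2 (vol Ω)) {φ : ℕ → EuclideanSpace ℝ (Fin N) → ℝ}
    (hφ : ∀ n, IsTestFunction Ω (φ n))
    (h₁ : Tendsto (fun n => eLpNorm (fun x => φ n x - w x) 2 (vol Ω)) atTop (𝓝 0))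
    (h₂ : Tendsto (fun n => eLpNorm (fun x => gradient (φ n) x - G x) 2 (vol Ω)) atTop (𝓝 0)) :
    MemH10 Ω w G where
  memH1 :=
    { memLp := hw
      memLp_grad := hG
      weak_grad := fun ψ hψ => by
        have l₁ := tendsto_integral_smul_of_tendsto_eLpNorm (fun n => (hφ n).memLp) hw
          hψ.memLp_gradient h₁
        have l₂ := (tendsto_integral_smul_of_tendsto_eLpNorm' (fun n => (hφ n).memLp_gradient) hG
          hψ.memLp h₂).neg
        refine tendsto_nhds_unique l₁ (l₂.congr fun n => ?_)
        exact ((hφ n).integral_smul_gradient hψ).symm }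
  approx := ⟨φ, hφ, h₁, h₂⟩

end TestFunctions

/-! ### H¹₀(Ω) as a Banach space of pairs. -/

section SobolevZero

variable {N : ℕ} (Ω : Set (EuclideanSpace ℝ (Fin N)))

/-- The pairs `(φ, Dφ)` with `φ ∈ 𝒟(Ω)`. -/
noncomputable def testPairs :
    Submodule ℝ (Lp ℝ 2 (vol Ω) × Lp (EuclideanSpace ℝ (Fin N)) 2 (vol Ω)) where
  carrier := {p | ∃ φ, IsTestFunction Ω φ ∧ p.1 =ᵐ[vol Ω] φ ∧ p.2 =ᵐ[vol Ω] gradient φ}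
  zero_mem' := ⟨0, IsTestFunction.zero, Lp.coeFn_zero _ _ _, by
    have : gradient (0 : EuclideanSpace ℝ (Fin N) → ℝ) = 0 := by
      ext1 x
      simp [gradient]
    rw [this]
    exact Lp.coeFn_zero _ _ _⟩
  add_mem' := by
    rintro p q ⟨φ, hφ, hp₁, hp₂⟩ ⟨ψ, hψ, hq₁, hq₂⟩
    refine ⟨φ + ψ, hφ.add hψ, (Lp.coeFn_add _ _).trans (hp₁.add hq₁), ?_⟩
    rw [hφ.gradient_add hψ]
    exact (Lp.coeFn_add _ _).trans (hp₂.add hq₂)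
  smul_mem' := by
    rintro c p ⟨φ, hφ, hp₁, hp₂⟩
    refine ⟨c • φ, hφ.const_smul c, (Lp.coeFn_smul _ _).trans (hp₁.const_smul c), ?_⟩
    rw [hφ.gradient_const_smul c]
    exact (Lp.coeFn_smul _ _).trans (hp₂.const_smul c)

/-- The space `H¹₀(Ω)`, realized as a space of pairs `(w, Dw)`. -/
noncomputable def sobolevZero :
    Submodule ℝ (Lp ℝ 2 (vol Ω) × Lp (EuclideanSpace ℝ (Fin N)) 2 (vol Ω)) :=
  (testPairs Ω).topologicalClosure

/-- The product carries the supremum norm, which is why `exists_rayleigh_minimizer` does not ask for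
an inner product on `H`. -/
instance : CompleteSpace (sobolevZero Ω) :=
  (Submodule.isClosed_topologicalClosure _).completeSpace_coe

variable {Ω}

theorem IsTestFunction.mem_sobolevZero {φ : EuclideanSpace ℝ (Fin N) → ℝ}
    (hφ : IsTestFunction Ω φ) :
    (hφ.memLp.toLp φ, hφ.memLp_gradient.toLp (gradient φ)) ∈ sobolevZero Ω :=
  Submodule.le_topologicalClosure _ ⟨φ, hφ, hφ.memLp.coeFn_toLp, hφ.memLp_gradient.coeFn_toLp⟩

theorem mem_sobolevZero_of_tendsto {w : ℕ → EuclideanSpace ℝ (Fin N) → ℝ}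
    {G : ℕ → EuclideanSpace ℝ (Fin N) → EuclideanSpace ℝ (Fin N)}
    {w₀ : EuclideanSpace ℝ (Fin N) → ℝ} {G₀ : EuclideanSpace ℝ (Fin N) → EuclideanSpace ℝ (Fin N)}
    (hw : ∀ n, MemLp (w n) 2 (vol Ω)) (hG : ∀ n, MemLp (G n) 2 (vol Ω))
    (hw₀ : MemLp w₀ 2 (vol Ω)) (hG₀ : MemLp G₀ 2 (vol Ω))
    (hmem : ∀ n, ((hw n).toLp (w n), (hG n).toLp (G n)) ∈ sobolevZero Ω)
    (h₁ : Tendsto (fun n => eLpNorm (w n - w₀) 2 (vol Ω)) atTop (𝓝 0))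
    (h₂ : Tendsto (fun n => eLpNorm (G n - G₀) 2 (vol Ω)) atTop (𝓝 0)) :
    (hw₀.toLp w₀, hG₀.toLp G₀) ∈ sobolevZero Ω :=
  (Submodule.isClosed_topologicalClosure (testPairs Ω)).mem_of_tendsto
    (((Lp.tendsto_Lp_iff_tendsto_eLpNorm'' _ hw _ hw₀).2 h₁).prodMk_nhds
      ((Lp.tendsto_Lp_iff_tendsto_eLpNorm'' _ hG _ hG₀).2 h₂))
    (Eventually.of_forall hmem)

theorem MemH10.mem_sobolevZero {w : EuclideanSpace ℝ (Fin N) → ℝ}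
    {G : EuclideanSpace ℝ (Fin N) → EuclideanSpace ℝ (Fin N)} (h : MemH10 Ω w G) :
    (h.memH1.memLp.toLp w, h.memH1.memLp_grad.toLp G) ∈ sobolevZero Ω := by
  obtain ⟨φ, hφ, h₁, h₂⟩ := h.approx
  exact mem_sobolevZero_of_tendsto (fun n => (hφ n).memLp) (fun n => (hφ n).memLp_gradient) _ _
    (fun n => (hφ n).mem_sobolevZero) h₁ h₂

/-- With `MemH10.mem_sobolevZero`, this identifies the predicate with points of a closed subspace,
making linearity and completeness available. -/
theorem memH10_of_mem_sobolevZero {p : Lp ℝ 2 (vol Ω) × Lp (EuclideanSpace ℝ (Fin N)) 2 (vol Ω)}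
    (hp : p ∈ sobolevZero Ω) : MemH10 Ω p.1 p.2 := by
  obtain ⟨q, hq, hlim⟩ := mem_closure_iff_seq_limit.1 hp
  choose φ hφ hφ₁ hφ₂ using hq
  refine memH10_of_approx (Lp.memLp _) (Lp.memLp _) hφ ?_ ?_
  · refine ((Lp.tendsto_Lp_iff_tendsto_eLpNorm' _ _).1
      ((continuous_fst.tendsto p).comp hlim)).congr fun n => ?_
    exact eLpNorm_congr_ae ((hφ₁ n).sub (ae_eq_refl _))
  · refine ((Lp.tendsto_Lp_iff_tendsto_eLpNorm' _ _).1
      ((continuous_snd.tendsto p).comp hlim)).congr fun n => ?_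
    exact eLpNorm_congr_ae ((hφ₂ n).sub (ae_eq_refl _))

theorem MemH10.congr {w w' : EuclideanSpace ℝ (Fin N) → ℝ}
    {G G' : EuclideanSpace ℝ (Fin N) → EuclideanSpace ℝ (Fin N)} (h : MemH10 Ω w G)
    (hw : w =ᵐ[vol Ω] w') (hG : G =ᵐ[vol Ω] G') : MemH10 Ω w' G' := by
  obtain ⟨φ, hφ, h₁, h₂⟩ := h.approx
  refine memH10_of_approx (h.memH1.memLp.ae_eq hw) (h.memH1.memLp_grad.ae_eq hG) hφ
    (h₁.congr fun n => eLpNorm_congr_ae ?_) (h₂.congr fun n => eLpNorm_congr_ae ?_)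
  · filter_upwards [hw] with x hx
    rw [hx]
  · filter_upwards [hG] with x hx
    rw [hx]

theorem memH10_of_toLp_mem {w : EuclideanSpace ℝ (Fin N) → ℝ}
    {G : EuclideanSpace ℝ (Fin N) → EuclideanSpace ℝ (Fin N)}
    (hw : MemLp w 2 (vol Ω)) (hG : MemLp G 2 (vol Ω))
    (h : (hw.toLp w, hG.toLp G) ∈ sobolevZero Ω) : MemH10 Ω w G :=
  (memH10_of_mem_sobolevZero h).congr hw.coeFn_toLp hG.coeFn_toLp

theorem MemH10.sub {w w' : EuclideanSpace ℝ (Fin N) → ℝ}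
    {G G' : EuclideanSpace ℝ (Fin N) → EuclideanSpace ℝ (Fin N)} (h : MemH10 Ω w G)
    (h' : MemH10 Ω w' G') : MemH10 Ω (w - w') (G - G') :=
  memH10_of_toLp_mem (h.memH1.memLp.sub h'.memH1.memLp) (h.memH1.memLp_grad.sub h'.memH1.memLp_grad)
    (Submodule.sub_mem _ h.mem_sobolevZero h'.mem_sobolevZero)

end SobolevZero

/-! ### Finite-dimensional spaces of step functions. -/

section StepFunctions

variable {α β : Type*} [MeasurableSpace α] [MeasurableSpace β] [MeasurableSingletonClass β]
  {μ : Measure α}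

theorem lp_coeFn_finset_sum {ι F : Type*} [NormedAddCommGroup F] {p : ℝ≥0∞} (s : Finset ι)
    (f : ι → Lp F p μ) : ⇑(∑ i ∈ s, f i) =ᵐ[μ] fun x => ∑ i ∈ s, f i x := by
  classical
  induction s using Finset.induction_on with
  | empty =>
    simp only [Finset.sum_empty]
    exact Lp.coeFn_zero F p μ
  | insert a s ha ih =>
    rw [Finset.sum_insert ha]
    filter_upwards [Lp.coeFn_add (f a) (∑ i ∈ s, f i), ih] with x h1 h2
    rw [h1, Pi.add_apply, h2, Finset.sum_insert ha]

/-- The square integrable functions which are constant on each of the fibres over `S` of `κ`, and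
vanish elsewhere. -/
noncomputable def fibreSpan (μ : Measure α) [IsFiniteMeasure μ] {κ : α → β} (hκ : Measurable κ)
    (S : Finset β) : Submodule ℝ (Lp ℝ 2 μ) :=
  Submodule.span ℝ (range fun k : S =>
    indicatorConstLp 2 (hκ (measurableSet_singleton (k : β))) (measure_ne_top μ _) (1 : ℝ))

variable [IsFiniteMeasure μ] {κ : α → β} (hκ : Measurable κ) (S : Finset β)

instance : FiniteDimensional ℝ (fibreSpan μ hκ S) :=
  FiniteDimensional.span_of_finite ℝ (finite_range _)

variable {S}

/-- Almost everywhere, `g ∘ κ` is the finite sum over `k ∈ S` of `g k` times the indicator of the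
fibre over `k`. -/
theorem toLp_mem_fibreSpan (hS : ∀ᵐ x ∂μ, κ x ∈ S) (g : β → ℝ)
    (hg : MemLp (fun x => g (κ x)) 2 μ) : hg.toLp ∈ fibreSpan μ hκ S := by
  classical
  have h : hg.toLp = ∑ k : S, g k • indicatorConstLp 2 (hκ (measurableSet_singleton (k : β)))
      (measure_ne_top μ _) (1 : ℝ) := by
    apply Lp.ext
    have h1 : ∀ᵐ x ∂μ, ∀ k : S, (g k • indicatorConstLp 2 (hκ (measurableSet_singleton (k : β)))
        (measure_ne_top μ _) (1 : ℝ) : Lp ℝ 2 μ) x = if κ x = k then g k else 0 := by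
      refine ae_all_iff.2 fun k => ?_
      filter_upwards [Lp.coeFn_smul (g k) (indicatorConstLp 2
        (hκ (measurableSet_singleton (k : β))) (measure_ne_top μ _) (1 : ℝ)),
        indicatorConstLp_coeFn (p := 2) (hs := hκ (measurableSet_singleton (k : β)))
          (hμs := measure_ne_top μ _) (c := (1 : ℝ))] with x h1 h2
      rw [h1, Pi.smul_apply, h2]
      simp [indicator_apply]
    filter_upwards [hg.coeFn_toLp, lp_coeFn_finset_sum (μ := μ) Finset.univ (fun k : S =>
      (g k • indicatorConstLp 2 (hκ (measurableSet_singleton (k : β)))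
        (measure_ne_top μ _) (1 : ℝ) : Lp ℝ 2 μ)), h1, hS] with x h2 h3 h4 h5
    rw [h2, h3]
    simp only [h4]
    rw [Finset.sum_eq_single (⟨κ x, h5⟩ : S)]
    · simp
    · intro b _ hb
      rw [if_neg]
      rintro h6
      exact hb (Subtype.ext h6.symm)
    · simp
  rw [h]
  exact Submodule.sum_mem _ fun k _ => Submodule.smul_mem _ _ (Submodule.subset_span ⟨k, rfl⟩)

end StepFunctions

/-! ### Rellich's compactness theorem. -/

section Rellich

variable {N : ℕ} {Ω : Set (EuclideanSpace ℝ (Fin N))}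

theorem finite_image_cell (hΩ : Bornology.IsBounded Ω) {h : ℝ} (hh : 0 < h) :
    (cell h '' Ω).Finite := by
  obtain ⟨R, hR⟩ := hΩ.exists_norm_le
  refine (Set.Finite.pi' (t := fun _ : Fin N => Icc ⌊-R / h⌋ ⌊R / h⌋)
    fun _ => finite_Icc _ _).subset ?_
  rintro _ ⟨x, hx, rfl⟩ i
  have h1 := abs_le.1 ((PiLp.norm_apply_le x i).trans (hR x hx))
  exact ⟨Int.floor_mono (by gcongr; exact h1.1), Int.floor_mono (by gcongr; exact h1.2)⟩

/-- The good sampling position depends on the function, so sampling is not a linear operator. The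
projection is linear and, being the nearest point, does at least as well. -/
theorem norm_sub_starProjection_le {H : Type*} [NormedAddCommGroup H] [InnerProductSpace ℝ H]
    (V : Submodule ℝ H) [V.HasOrthogonalProjection] (x : H) {v : H} (hv : v ∈ V) :
    ‖x - V.starProjection x‖ ≤ ‖x - v‖ := by
  rw [V.starProjection_minimal x]
  exact ciInf_le ⟨0, by rintro _ ⟨y, rfl⟩; exact norm_nonneg _⟩ (⟨v, hv⟩ : V)

theorem isCompactOperator_starProjection {H : Type*} [NormedAddCommGroup H] [InnerProductSpace ℝ H]
    (V : Submodule ℝ H) [FiniteDimensional ℝ V] : IsCompactOperator V.starProjection := by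
  have := FiniteDimensional.proper ℝ V
  exact (isCompactOperator_of_locallyCompactSpace_dom
    V.orthogonalProjectionOnto).clm_comp V.subtypeL

theorem eLpNorm_two_sq {α F : Type*} [MeasurableSpace α] [NormedAddCommGroup F] {μ : Measure α}
    (f : α → F) : eLpNorm f 2 μ ^ 2 = ∫⁻ x, ‖f x‖ₑ ^ 2 ∂μ := by
  rw [eLpNorm_eq_lintegral_rpow_enorm_toReal two_ne_zero ENNReal.ofNat_ne_top,
    ← ENNReal.rpow_natCast, ← ENNReal.rpow_mul]
  norm_num

/-- The step functions on the grid of mesh `h` approximate a test function in `L²(Ω)`, with an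
error of order `h` with respect to its gradient. -/
theorem norm_sub_starProjection_fibreSpan_le [IsFiniteMeasure (vol Ω)] (hΩ : MeasurableSet Ω)
    {h : ℝ} (hh : 0 < h) {S : Finset (Fin N → ℤ)} (hS : ∀ x ∈ Ω, cell h x ∈ S)
    {φ : EuclideanSpace ℝ (Fin N) → ℝ} (hφ : IsTestFunction Ω φ) :
    ‖hφ.memLp.toLp φ
        - (fibreSpan (vol Ω) (measurable_cell h) S).starProjection (hφ.memLp.toLp φ)‖
      ≤ √(2 ^ N * N) * h * ‖(hφ.memLp_gradient.toLp (gradient φ) :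
          Lp (EuclideanSpace ℝ (Fin N)) 2 (vol Ω))‖ := by
  obtain ⟨y, hy⟩ := exists_sample_lintegral_sub_sq_le hh (hφ.smooth.of_le (by norm_cast))
  set g : (Fin N → ℤ) → ℝ := fun k => φ (cellCorner h k + y) with hg
  obtain ⟨M, hM⟩ := hφ.smooth.continuous.bounded_above_of_compact_support hφ.compact
  have hgm : MemLp (fun x => g (cell h x)) 2 (vol Ω) :=
    MemLp.of_bound (((measurable_of_countable g).comp (measurable_cell h)).aestronglyMeasurable) M
      (Eventually.of_forall fun x => hM _)
  refine (norm_sub_starProjection_le _ _ (toLp_mem_fibreSpan (measurable_cell h)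
    ((ae_restrict_iff' hΩ).2 (Eventually.of_forall hS)) g hgm)).trans ?_
  rw [← MemLp.toLp_sub, Lp.norm_toLp, Lp.norm_toLp]
  -- The compact support in Ω enters here: the gradient vanishes off Ω, so the whole-space estimate
  -- is an estimate on Ω.
  have hgrad : ∫⁻ x, ‖fderiv ℝ φ x‖ₑ ^ 2 = eLpNorm (gradient φ) 2 (vol Ω) ^ 2 := by
    rw [eLpNorm_two_sq, setLIntegral_eq_of_support_subset]
    · refine lintegral_congr fun x => ?_
      rw [← ofReal_norm, ← ofReal_norm, norm_gradient_eq]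
    · intro x hx
      by_contra h1
      exact hx (by simp [hφ.gradient_eq_zero_of_notMem h1])
  have hle : eLpNorm (φ - fun x => g (cell h x)) 2 (vol Ω) ^ 2
      ≤ (ENNReal.ofReal (√(2 ^ N * N) * h) * eLpNorm (gradient φ) 2 (vol Ω)) ^ 2 := by
    rw [eLpNorm_two_sq, mul_pow, ← hgrad, ← ENNReal.ofReal_pow (by positivity), mul_pow,
      Real.sq_sqrt (by positivity)]
    refine le_trans ?_ hy
    refine (setLIntegral_le_lintegral _ _).trans (lintegral_mono fun x => le_of_eq ?_)
    rw [Pi.sub_apply, ← enorm_neg, neg_sub]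
  have hle' := (ENNReal.pow_le_pow_left_iff two_ne_zero).1 hle
  have h3 := ENNReal.toReal_mono 
    (ENNReal.mul_ne_top ENNReal.ofReal_ne_top hφ.memLp_gradient.eLpNorm_lt_top.ne) hle'
  rwa [ENNReal.toReal_mul, ENNReal.toReal_ofReal (by positivity)] at h3

/-- The embedding of `H¹₀(Ω)` into `L²(Ω)`. -/
noncomputable def sobolevZeroFst (Ω : Set (EuclideanSpace ℝ (Fin N))) :
    sobolevZero Ω →L[ℝ] Lp ℝ 2 (vol Ω) :=
  (ContinuousLinearMap.fst ℝ _ _).comp (sobolevZero Ω).subtypeL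

/-- Rellich's theorem for `H¹₀(Ω)`. -/
theorem isCompactOperator_sobolevZeroFst (hΩ : MeasurableSet Ω) (hb : Bornology.IsBounded Ω) :
    IsCompactOperator (sobolevZeroFst Ω) := by
  have : IsFiniteMeasure (vol Ω) := isFiniteMeasure_restrict.2 hb.measure_lt_top.ne
  set h : ℕ → ℝ := fun n => 1 / ((n : ℝ) + 1) with hh
  have hpos : ∀ n, 0 < h n := fun n => by positivity
  set P : ℕ → Lp ℝ 2 (vol Ω) →L[ℝ] Lp ℝ 2 (vol Ω) := fun n =>
    (fibreSpan (vol Ω) (measurable_cell (h n))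
      (finite_image_cell hb (hpos n)).toFinset).starProjection with hP
  have hbound : ∀ n, ∀ p ∈ sobolevZero Ω,
      ‖p.1 - P n p.1‖ ≤ √(2 ^ N * N) * h n * ‖p.2‖ := by
    intro n p hp
    -- Both sides are continuous in the pair, so the bound for test functions passes to their
    -- closure.
    have hcl : IsClosed {p : Lp ℝ 2 (vol Ω) × Lp (EuclideanSpace ℝ (Fin N)) 2 (vol Ω) |
        ‖p.1 - P n p.1‖ ≤ √(2 ^ N * N) * h n * ‖p.2‖} :=
      isClosed_le (by fun_prop) (by fun_prop)
    refine closure_minimal ?_ hcl hp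
    rintro ⟨q₁, q₂⟩ ⟨φ, hφ, hq₁, hq₂⟩
    have e₁ : q₁ = hφ.memLp.toLp φ := Lp.ext (hq₁.trans hφ.memLp.coeFn_toLp.symm)
    have e₂ : q₂ = hφ.memLp_gradient.toLp (gradient φ) :=
      Lp.ext (hq₂.trans hφ.memLp_gradient.coeFn_toLp.symm)
    simp only [mem_ofPred_eq, e₁, e₂]
    exact norm_sub_starProjection_fibreSpan_le hΩ (hpos n) (fun x hx => by
      rw [Set.Finite.mem_toFinset]; exact ⟨x, hx, rfl⟩) hφ
  -- An operator-norm limit of compact operators is compact; the mesh `h n` tends to 0.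
  refine isCompactOperator_of_tendsto (l := atTop) (F := fun n => (P n).comp (sobolevZeroFst Ω)) ?_
    (Eventually.of_forall fun n => IsCompactOperator.comp_clm (f := P n)
      (isCompactOperator_starProjection _) (sobolevZeroFst Ω))
  rw [tendsto_iff_norm_sub_tendsto_zero]
  have hlim : Tendsto (fun n => √(2 ^ N * N) * h n) atTop (𝓝 0) := by
    simpa [hh] using (tendsto_one_div_add_atTop_nhds_zero_nat (𝕜 := ℝ)).const_mul (√(2 ^ N * N))
  refine squeeze_zero (fun _ => norm_nonneg _) (fun n => ?_) hlim
  refine ContinuousLinearMap.opNorm_le_bound _ (by positivity) fun p => ?_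
  rw [sub_apply, norm_sub_rev]
  refine (hbound n p p.2).trans ?_
  gcongr
  exact norm_snd_le (p : Lp ℝ 2 (vol Ω) × Lp (EuclideanSpace ℝ (Fin N)) 2 (vol Ω))

end Rellich

/-! ### Dominated convergence in L². -/

section DominatedConvergence

theorem tendsto_eLpNorm_two_of_dominated {α F : Type*} [MeasurableSpace α] {μ : Measure α}
    [NormedAddCommGroup F] {f : ℕ → α → F} {f₀ : α → F} {b : α → ℝ}
    (hf : ∀ n, AEStronglyMeasurable (f n) μ) (hf₀ : AEStronglyMeasurable f₀ μ) (hb : MemLp b 2 μ)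
    (hle : ∀ n, ∀ᵐ x ∂μ, ‖f n x - f₀ x‖ ≤ b x)
    (hlim : ∀ᵐ x ∂μ, Tendsto (fun n => f n x) atTop (𝓝 (f₀ x))) :
    Tendsto (fun n => eLpNorm (f n - f₀) 2 μ) atTop (𝓝 0) := by
  have h : Tendsto (fun n => ∫⁻ x, ‖f n x - f₀ x‖ₑ ^ 2 ∂μ) atTop (𝓝 (∫⁻ _x, 0 ∂μ)) := by
    refine tendsto_lintegral_of_dominated_convergence' (fun x => ‖b x‖ₑ ^ 2)
      (fun n => (((hf n).sub hf₀).enorm.pow_const 2)) (fun n => ?_) ?_ ?_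
    · filter_upwards [hle n] with x hx
      gcongr
      rw [← ofReal_norm, ← ofReal_norm]
      exact ENNReal.ofReal_le_ofReal (hx.trans (Real.le_norm_self _))
    · rw [← eLpNorm_two_sq]
      exact ENNReal.pow_ne_top hb.eLpNorm_lt_top.ne
    · filter_upwards [hlim] with x hx
      have h1 := ((ENNReal.continuous_pow 2).tendsto _).comp (hx.sub_const (f₀ x)).enorm
      simpa [Function.comp_def] using h1
  rw [lintegral_zero] at h
  have h2 := ((ENNReal.continuous_rpow_const (y := 1 / 2)).tendsto _).comp h
  have h0 : (0 : ℝ≥0∞) ^ (1 / 2 : ℝ) = 0 := ENNReal.zero_rpow_of_pos (by norm_num)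
  rw [h0] at h2
  refine h2.congr fun n => ?_
  change (∫⁻ x, ‖(f n - f₀) x‖ₑ ^ 2 ∂μ) ^ (1 / 2 : ℝ) = _
  rw [← eLpNorm_two_sq, ← ENNReal.rpow_natCast, ← ENNReal.rpow_mul]
  norm_num

end DominatedConvergence

/-! ### The chain rule in H¹₀(Ω). -/

section ChainRule

variable {N : ℕ} {Ω : Set (EuclideanSpace ℝ (Fin N))}

theorem IsTestFunction.comp_left {φ : EuclideanSpace ℝ (Fin N) → ℝ} (hφ : IsTestFunction Ω φ)
    {Γ : ℝ → ℝ} (hΓ : ContDiff ℝ ∞ Γ) (hΓ0 : Γ 0 = 0) : IsTestFunction Ω (Γ ∘ φ) where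
  smooth := hΓ.comp hφ.smooth
  compact := hφ.compact.comp_left hΓ0
  support_subset := (tsupport_comp_subset hΓ0 φ).trans hφ.support_subset

theorem gradient_comp_left {φ : EuclideanSpace ℝ (Fin N) → ℝ} (hφ : Differentiable ℝ φ)
    {Γ : ℝ → ℝ} (hΓ : Differentiable ℝ Γ) (x : EuclideanSpace ℝ (Fin N)) :
    gradient (Γ ∘ φ) x = deriv Γ (φ x) • gradient φ x := by
  have h := (hΓ (φ x)).hasDerivAt.comp_hasFDerivAt x (hφ x).hasFDerivAt
  rw [gradient, h.fderiv, map_smul, gradient]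

theorem abs_sub_le_of_abs_deriv_le_one {Γ : ℝ → ℝ} (hΓ : Differentiable ℝ Γ)
    (hb : ∀ t, |deriv Γ t| ≤ 1) (s t : ℝ) : |Γ s - Γ t| ≤ |s - t| := by
  have h := Convex.norm_image_sub_le_of_norm_deriv_le (s := univ) (C := 1)
    (fun x _ => hΓ x) (fun x _ => hb x) convex_univ (mem_univ t) (mem_univ s)
  simpa using h

/-- The chain rule in `H¹₀(Ω)`, for the composition with a smooth contraction. -/
theorem MemH10.comp_left {w : EuclideanSpace ℝ (Fin N) → ℝ}
    {G : EuclideanSpace ℝ (Fin N) → EuclideanSpace ℝ (Fin N)} (h : MemH10 Ω w G)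
    {Γ : ℝ → ℝ} (hΓ : ContDiff ℝ ∞ Γ) (hΓ0 : Γ 0 = 0) (hb : ∀ t, |deriv Γ t| ≤ 1) :
    MemH10 Ω (Γ ∘ w) (fun x => deriv Γ (w x) • G x) := by
  have hΓd : Differentiable ℝ Γ := hΓ.differentiable (by simp)
  have hΓ' : Continuous (deriv Γ) := hΓ.continuous_deriv (by simp)
  have hw := h.memH1.memLp
  have hG := h.memH1.memLp_grad
  obtain ⟨φ, hφ, h₁, h₂⟩ := h.approx
  -- The factor `deriv Γ (φ n)` converges only where `φ n` does, hence the a.e. convergent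
  -- subsequence.
  obtain ⟨ns, hns, hae⟩ := (tendstoInMeasure_of_tendsto_eLpNorm two_ne_zero
    (fun n => (hφ n).smooth.continuous.aestronglyMeasurable) hw.1 h₁).exists_seq_tendsto_ae
  have hw' : MemLp (Γ ∘ w) 2 (vol Ω) :=
    hw.mono (hΓ.continuous.comp_aestronglyMeasurable hw.1) (Eventually.of_forall fun x => by
      simpa [hΓ0] using abs_sub_le_of_abs_deriv_le_one hΓd hb (w x) 0)
  have hG' : MemLp (fun x => deriv Γ (w x) • G x) 2 (vol Ω) :=
    hG.mono ((hΓ'.comp_aestronglyMeasurable hw.1).smul hG.1) (Eventually.of_forall fun x => by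
      rw [norm_smul]
      exact mul_le_of_le_one_left (norm_nonneg _) (hb _))
  refine memH10_of_approx hw' hG' (φ := fun n => Γ ∘ φ (ns n))
    (fun n => (hφ _).comp_left hΓ hΓ0) ?_ ?_
  · refine tendsto_of_tendsto_of_tendsto_of_le_of_le tendsto_const_nhds
      (h₁.comp hns.tendsto_atTop) (fun _ => zero_le) fun n => ?_
    exact eLpNorm_mono fun x => abs_sub_le_of_abs_deriv_le_one hΓd hb _ _
  · have mΓ : ∀ n, AEStronglyMeasurable (fun x => deriv Γ (φ (ns n) x)) (vol Ω) := fun n =>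
      (hΓ'.comp (hφ (ns n)).smooth.continuous).aestronglyMeasurable
    -- The gradient error splits as Γ'(φₙ)(Dφₙ - G) + (Γ'(φₙ) - Γ'(w))G: the first term is
    -- controlled by |Γ'| ≤ 1, the second by domination by 2|G|.
    have l₁ : Tendsto (fun n => eLpNorm
        (fun x => deriv Γ (φ (ns n) x) • (gradient (φ (ns n)) x - G x)) 2 (vol Ω)) atTop (𝓝 0) := by
      refine tendsto_of_tendsto_of_tendsto_of_le_of_le tendsto_const_nhds
        (h₂.comp hns.tendsto_atTop) (fun _ => zero_le) fun n => ?_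
      refine eLpNorm_mono fun x => ?_
      rw [norm_smul]
      exact mul_le_of_le_one_left (norm_nonneg _) (hb _)
    have l₂ : Tendsto (fun n => eLpNorm ((fun x => deriv Γ (φ (ns n) x) • G x)
        - fun x => deriv Γ (w x) • G x) 2 (vol Ω)) atTop (𝓝 0) := by
      refine tendsto_eLpNorm_two_of_dominated (b := fun x => 2 * ‖G x‖)
        (fun n => (mΓ n).smul hG.1) hG'.1
        (hG.norm.const_mul 2) (fun n => Eventually.of_forall fun x => ?_) ?_
      · rw [← sub_smul, norm_smul]
        gcongr
        rw [Real.norm_eq_abs]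
        have h1 := abs_le.1 (hb (φ (ns n) x))
        have h2 := abs_le.1 (hb (w x))
        exact abs_le.2 ⟨by linarith, by linarith⟩
      · filter_upwards [hae] with x hx
        exact ((hΓ'.tendsto (w x)).comp hx).smul_const (G x)
    have l₃ := l₁.add l₂
    rw [add_zero] at l₃
    refine tendsto_of_tendsto_of_tendsto_of_le_of_le tendsto_const_nhds l₃
      (fun _ => zero_le) fun n => ?_
    have m₁ : AEStronglyMeasurable
        (fun x => deriv Γ (φ (ns n) x) • (gradient (φ (ns n)) x - G x)) (vol Ω) :=
      (mΓ n).smul ((hφ _).continuous_gradient.aestronglyMeasurable.sub hG.1)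
    have m₂ : AEStronglyMeasurable ((fun x => deriv Γ (φ (ns n) x) • G x)
        - fun x => deriv Γ (w x) • G x) (vol Ω) :=
      ((mΓ n).smul hG.1).sub hG'.1
    refine le_trans (le_of_eq ?_) (eLpNorm_add_le m₁ m₂ one_le_two)
    congr 1
    ext1 x
    rw [gradient_comp_left (hφ _).differentiable hΓd]
    simp [smul_sub]

end ChainRule

/-! ### Smoothing the positive part. -/

section PositivePart

/-- A smooth nondecreasing contraction which differs from the positive part by at most `1`. -/
noncomputable def smoothPos (t : ℝ) : ℝ := ∫ s in (0 : ℝ)..t, Real.smoothTransition s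

theorem hasDerivAt_smoothPos (t : ℝ) : HasDerivAt smoothPos (Real.smoothTransition t) t :=
  intervalIntegral.integral_hasDerivAt_right
    (Real.smoothTransition.continuous.intervalIntegrable _ _)
    (Real.smoothTransition.continuous.stronglyMeasurableAtFilter _ _)
    Real.smoothTransition.continuousAt

theorem contDiff_smoothPos : ContDiff ℝ ∞ smoothPos := by
  rw [contDiff_infty_iff_deriv]
  refine ⟨fun t => (hasDerivAt_smoothPos t).differentiableAt, ?_⟩
  rw [funext fun t => (hasDerivAt_smoothPos t).deriv]
  exact Real.smoothTransition.contDiff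

/-- The derivative lies in [0, 1] and agrees with that of the positive part outside [0, 1]. The
error is therefore accumulated on an interval of length 1. -/
theorem abs_smoothPos_sub_max_le (t : ℝ) : |smoothPos t - max t 0| ≤ 1 := by
  have hc := Real.smoothTransition.continuous
  have hi : ∀ a b : ℝ, IntervalIntegrable Real.smoothTransition volume a b :=
    fun a b => hc.intervalIntegrable a b
  have hle : ∀ {a b : ℝ}, a ≤ b → ∫ s in a..b, Real.smoothTransition s ≤ b - a := by
    intro a b hab
    have h := intervalIntegral.integral_mono hab (hi a b)
      (intervalIntegrable_const (c := (1 : ℝ))) Real.smoothTransition.le_one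
    simpa using h
  have hge : ∀ {a b : ℝ}, a ≤ b → 0 ≤ ∫ s in a..b, Real.smoothTransition s := fun hab =>
    intervalIntegral.integral_nonneg hab fun s _ => Real.smoothTransition.nonneg s
  rcases le_total t 0 with ht | ht
  · have h : smoothPos t = ∫ _s in (0 : ℝ)..t, (0 : ℝ) := by
      refine intervalIntegral.integral_congr fun s hs => ?_
      rw [uIcc_of_ge ht] at hs
      exact Real.smoothTransition.zero_of_nonpos hs.2
    rw [h, max_eq_right ht]
    simp
  · rw [max_eq_left ht]
    rcases le_total t 1 with ht1 | ht1
    · have h1 : smoothPos t ≤ t - 0 := hle ht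
      have h2 : 0 ≤ smoothPos t := hge ht
      exact abs_le.2 ⟨by linarith, by linarith⟩
    · have h : smoothPos t = smoothPos 1 + ∫ _s in (1 : ℝ)..t, (1 : ℝ) := by
        rw [smoothPos, ← intervalIntegral.integral_add_adjacent_intervals (hi 0 1) (hi 1 t),
          smoothPos]
        congr 1
        refine intervalIntegral.integral_congr fun s hs => ?_
        rw [uIcc_of_le ht1] at hs
        exact Real.smoothTransition.one_of_one_le hs.1
      rw [h, intervalIntegral.integral_const]
      have h1 : smoothPos 1 ≤ 1 - 0 := hle zero_le_one
      have h2 : 0 ≤ smoothPos 1 := hge zero_le_one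
      simp only [smul_eq_mul, mul_one]
      exact abs_le.2 ⟨by linarith, by linarith⟩

/-- Smooth contractions which converge to the positive part. -/
noncomputable def smoothPosApprox (n : ℕ) (t : ℝ) : ℝ := smoothPos ((n + 1) * t) / (n + 1)

theorem hasDerivAt_smoothPosApprox (n : ℕ) (t : ℝ) :
    HasDerivAt (smoothPosApprox n) (Real.smoothTransition ((n + 1) * t)) t := by
  have h1 : HasDerivAt (fun t : ℝ => ((n : ℝ) + 1) * t) ((n : ℝ) + 1) t := by
    simpa using (hasDerivAt_id t).const_mul ((n : ℝ) + 1)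
  have h2 := ((hasDerivAt_smoothPos (((n : ℝ) + 1) * t)).comp t h1).div_const ((n : ℝ) + 1)
  rwa [mul_div_cancel_right₀ _ (by positivity)] at h2

theorem contDiff_smoothPosApprox (n : ℕ) : ContDiff ℝ ∞ (smoothPosApprox n) :=
  (contDiff_smoothPos.comp (contDiff_const.mul contDiff_id)).div_const _

theorem smoothPosApprox_zero (n : ℕ) : smoothPosApprox n 0 = 0 := by
  simp [smoothPosApprox, smoothPos]

theorem deriv_smoothPosApprox (n : ℕ) (t : ℝ) :
    deriv (smoothPosApprox n) t = Real.smoothTransition ((n + 1) * t) :=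
  (hasDerivAt_smoothPosApprox n t).deriv

theorem abs_deriv_smoothPosApprox_le (n : ℕ) (t : ℝ) : |deriv (smoothPosApprox n) t| ≤ 1 := by
  rw [deriv_smoothPosApprox, abs_of_nonneg (Real.smoothTransition.nonneg _)]
  exact Real.smoothTransition.le_one _

theorem tendsto_smoothPosApprox (t : ℝ) :
    Tendsto (fun n => smoothPosApprox n t) atTop (𝓝 (max t 0)) := by
  rw [tendsto_iff_norm_sub_tendsto_zero]
  refine squeeze_zero (fun _ => norm_nonneg _) (fun n => ?_)
    (tendsto_one_div_add_atTop_nhds_zero_nat (𝕜 := ℝ))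
  have hn : (0 : ℝ) < n + 1 := by positivity
  have h := abs_smoothPos_sub_max_le ((n + 1) * t)
  have e : smoothPosApprox n t - max t 0
      = (smoothPos ((n + 1) * t) - max ((n + 1) * t) 0) / (n + 1) := by
    have : max (((n : ℝ) + 1) * t) 0 = (n + 1) * max t 0 := by
      rw [mul_max_of_nonneg _ _ hn.le, mul_zero]
    rw [smoothPosApprox, this]
    field_simp
  rw [e, norm_div, Real.norm_eq_abs, Real.norm_of_nonneg hn.le]
  gcongr

/-- The transition function vanishes at 0, so the limit at t = 0 is 0. This selects the open
half-line and the value 0 for the gradient on {w = 0}. -/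
theorem tendsto_deriv_smoothPosApprox (t : ℝ) :
    Tendsto (fun n => deriv (smoothPosApprox n) t) atTop (𝓝 ((Ioi 0).indicator 1 t)) := by
  simp only [deriv_smoothPosApprox]
  rcases le_or_gt t 0 with ht | ht
  · rw [indicator_of_notMem (notMem_Ioi.2 ht)]
    refine tendsto_const_nhds.congr fun n => ?_
    exact (Real.smoothTransition.zero_of_nonpos
      (mul_nonpos_of_nonneg_of_nonpos (by positivity) ht)).symm
  · rw [indicator_of_mem (mem_Ioi.2 ht), Pi.one_apply]
    refine tendsto_const_nhds.congr' ?_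
    obtain ⟨m, hm⟩ := exists_nat_gt (1 / t)
    filter_upwards [eventually_ge_atTop m] with n hn
    refine (Real.smoothTransition.one_of_one_le ?_).symm
    rw [div_lt_iff₀ ht] at hm
    have : (m : ℝ) ≤ n := by exact_mod_cast hn
    nlinarith

variable {N : ℕ} {Ω : Set (EuclideanSpace ℝ (Fin N))}

/-- Stampacchia's theorem for the positive part. -/
theorem MemH10.posPart {w : EuclideanSpace ℝ (Fin N) → ℝ}
    {G : EuclideanSpace ℝ (Fin N) → EuclideanSpace ℝ (Fin N)} (h : MemH10 Ω w G) :
    MemH10 Ω (fun x => max (w x) 0) (fun x => (Ioi (0 : ℝ)).indicator (1 : ℝ → ℝ) (w x) • G x) := by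
  have hw := h.memH1.memLp
  have hG := h.memH1.memLp_grad
  have hn := fun n => h.comp_left (contDiff_smoothPosApprox n) (smoothPosApprox_zero n)
    (abs_deriv_smoothPosApprox_le n)
  have hind : ∀ t : ℝ, |(Ioi (0 : ℝ)).indicator (1 : ℝ → ℝ) t| ≤ 1 := by
    intro t
    by_cases ht : t ∈ Ioi (0 : ℝ)
    · simp [indicator_of_mem ht]
    · simp [indicator_of_notMem ht]
  have hw' : MemLp (fun x => max (w x) 0) 2 (vol Ω) :=
    hw.mono ((continuous_id.max continuous_const).comp_aestronglyMeasurable hw.1)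
      (Eventually.of_forall fun x => by
        simpa using abs_max_sub_max_le_abs (w x) 0 0)
  have hindm : AEStronglyMeasurable (fun x => (Ioi (0 : ℝ)).indicator (1 : ℝ → ℝ) (w x)) (vol Ω) :=
    ((measurable_one.indicator measurableSet_Ioi).comp_aemeasurable
      hw.1.aemeasurable).aestronglyMeasurable
  have hG' : MemLp (fun x => (Ioi (0 : ℝ)).indicator (1 : ℝ → ℝ) (w x) • G x) 2 (vol Ω) :=
    hG.mono (hindm.smul hG.1) (Eventually.of_forall fun x => by
      rw [norm_smul]
      exact mul_le_of_le_one_left (norm_nonneg _) (hind _))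
  -- The smoothed functions lie in the closed subspace `sobolevZero Ω`; dominated convergence of
  -- values and gradients puts the limit there too.
  refine memH10_of_toLp_mem hw' hG' (mem_sobolevZero_of_tendsto (fun n => (hn n).memH1.memLp)
    (fun n => (hn n).memH1.memLp_grad) hw' hG' (fun n => (hn n).mem_sobolevZero) ?_ ?_)
  · refine tendsto_eLpNorm_two_of_dominated (b := fun x => 2 * ‖w x‖)
      (fun n => (hn n).memH1.memLp.1) hw'.1 (hw.norm.const_mul 2)
      (fun n => Eventually.of_forall fun x => ?_)
      (Eventually.of_forall fun x => tendsto_smoothPosApprox (w x))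
    have h1 := abs_sub_le_of_abs_deriv_le_one
      ((contDiff_smoothPosApprox n).differentiable (by simp)) (abs_deriv_smoothPosApprox_le n)
      (w x) 0
    rw [smoothPosApprox_zero, sub_zero, sub_zero] at h1
    have h2 : |max (w x) 0| ≤ |w x| := by simpa using abs_max_sub_max_le_abs (w x) 0 0
    have h3 := norm_sub_le (smoothPosApprox n (w x)) (max (w x) 0)
    simp only [Real.norm_eq_abs, Function.comp_apply] at h3 ⊢
    linarith
  · refine tendsto_eLpNorm_two_of_dominated (b := fun x => 2 * ‖G x‖)
      (fun n => (hn n).memH1.memLp_grad.1) hG'.1 (hG.norm.const_mul 2)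
      (fun n => Eventually.of_forall fun x => ?_)
      (Eventually.of_forall fun x => (tendsto_deriv_smoothPosApprox (w x)).smul_const _)
    rw [← sub_smul, norm_smul]
    gcongr
    have h1 := abs_le.1 (abs_deriv_smoothPosApprox_le n (w x))
    have h2 := abs_le.1 (hind (w x))
    rw [Real.norm_eq_abs]
    exact abs_le.2 ⟨by linarith, by linarith⟩

end PositivePart

/-! ### The bilinear form of the operator. -/

section Energy

variable {N : ℕ} {Ω : Set (EuclideanSpace ℝ (Fin N))}
  {A : EuclideanSpace ℝ (Fin N) → Matrix (Fin N) (Fin N) ℝ}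
  {G G' Φ Φ' : EuclideanSpace ℝ (Fin N) → EuclideanSpace ℝ (Fin N)}

theorem BoundedCoercive.integrable (hA : BoundedCoercive Ω A) (hG : MemLp G 2 (vol Ω))
    (hΦ : MemLp Φ 2 (vol Ω)) :
    Integrable (fun x => (Φ x).ofLp ⬝ᵥ (A x *ᵥ (G x).ofLp)) (vol Ω) := by
  have hcoord : ∀ {G : EuclideanSpace ℝ (Fin N) → EuclideanSpace ℝ (Fin N)},
      MemLp G 2 (vol Ω) → ∀ i, MemLp (fun x => G x i) 2 (vol Ω) := fun hG i =>
    (EuclideanSpace.proj (𝕜 := ℝ) i).comp_memLp' hG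
  simp only [dotProduct, Matrix.mulVec]
  refine integrable_finsetSum _ fun i _ => ?_
  have h : MemLp (fun x => ∑ j, A x i j * G x j) 2 (vol Ω) :=
    memLp_finsetSum _ fun j _ => (hcoord hG j).mul (hA.bounded i j)
  exact (hcoord hΦ i).integrable_mul h

theorem BoundedCoercive.energy_add_left (hA : BoundedCoercive Ω A) (hG : MemLp G 2 (vol Ω))
    (hG' : MemLp G' 2 (vol Ω)) (hΦ : MemLp Φ 2 (vol Ω)) :
    energy Ω A (G + G') Φ = energy Ω A G Φ + energy Ω A G' Φ := by
  unfold energy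
  rw [← integral_add (hA.integrable hG hΦ) (hA.integrable hG' hΦ)]
  simp only [Pi.add_apply, WithLp.ofLp_add, Matrix.mulVec_add, dotProduct_add]

theorem BoundedCoercive.energy_sub_left (hA : BoundedCoercive Ω A) (hG : MemLp G 2 (vol Ω))
    (hG' : MemLp G' 2 (vol Ω)) (hΦ : MemLp Φ 2 (vol Ω)) :
    energy Ω A (G - G') Φ = energy Ω A G Φ - energy Ω A G' Φ := by
  unfold energy
  rw [← integral_sub (hA.integrable hG hΦ) (hA.integrable hG' hΦ)]
  simp only [Pi.sub_apply, WithLp.ofLp_sub, Matrix.mulVec_sub, dotProduct_sub]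

theorem BoundedCoercive.energy_add_right (hA : BoundedCoercive Ω A) (hG : MemLp G 2 (vol Ω))
    (hΦ : MemLp Φ 2 (vol Ω)) (hΦ' : MemLp Φ' 2 (vol Ω)) :
    energy Ω A G (Φ + Φ') = energy Ω A G Φ + energy Ω A G Φ' := by
  unfold energy
  rw [← integral_add (hA.integrable hG hΦ) (hA.integrable hG hΦ')]
  simp only [Pi.add_apply, WithLp.ofLp_add, add_dotProduct]

theorem energy_smul_left (c : ℝ) : energy Ω A (c • G) Φ = c * energy Ω A G Φ := by
  unfold energy
  rw [← integral_const_mul]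
  simp only [Pi.smul_apply, WithLp.ofLp_smul, Matrix.mulVec_smul, dotProduct_smul, smul_eq_mul]

theorem energy_smul_right (c : ℝ) : energy Ω A G (c • Φ) = c * energy Ω A G Φ := by
  unfold energy
  rw [← integral_const_mul]
  simp only [Pi.smul_apply, WithLp.ofLp_smul, smul_dotProduct, smul_eq_mul]

theorem energy_congr (hG : G =ᵐ[vol Ω] G') (hΦ : Φ =ᵐ[vol Ω] Φ') :
    energy Ω A G Φ = energy Ω A G' Φ' := by
  refine integral_congr_ae ?_
  filter_upwards [hG, hΦ] with x h1 h2
  rw [h1, h2]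

theorem energy_symmPart_comm : energy Ω (symmPart A) G Φ = energy Ω (symmPart A) Φ G := by
  refine integral_congr_ae (Eventually.of_forall fun x => ?_)
  have h : (symmPart A x)ᵀ = symmPart A x := by
    simp [symmPart, add_comm]
  dsimp only
  rw [Matrix.dotProduct_mulVec, ← Matrix.mulVec_transpose, h, dotProduct_comm]

/-- The antisymmetric part drops out on the diagonal. This links the possibly nonsymmetric equation
to the eigenvalues of the symmetrized operator. -/
theorem dotProduct_symmPart_mulVec (x : EuclideanSpace ℝ (Fin N)) (ξ : Fin N → ℝ) :
    ξ ⬝ᵥ (symmPart A x *ᵥ ξ) = ξ ⬝ᵥ (A x *ᵥ ξ) := by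
  have h : ξ ⬝ᵥ ((A x)ᵀ *ᵥ ξ) = ξ ⬝ᵥ (A x *ᵥ ξ) := by
    rw [Matrix.mulVec_transpose, dotProduct_comm, ← Matrix.dotProduct_mulVec]
  rw [symmPart, Matrix.smul_mulVec, Matrix.add_mulVec, dotProduct_smul, dotProduct_add, h]
  simp only [smul_eq_mul]
  ring

theorem energy_symmPart_self : energy Ω (symmPart A) G G = energy Ω A G G := by
  simp only [energy, dotProduct_symmPart_mulVec]

theorem BoundedCoercive.symmPart (hA : BoundedCoercive Ω A) :
    BoundedCoercive Ω (symmPart A) where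
  bounded i j := by
    have h := ((hA.bounded i j).add (hA.bounded j i)).const_mul (1 / 2)
    simpa [SingularDirichlet.symmPart] using h
  coercive := by
    obtain ⟨α, hα, h⟩ := hA.coercive
    refine ⟨α, hα, ?_⟩
    filter_upwards [h] with x hx ξ
    rw [dotProduct_symmPart_mulVec]
    exact hx ξ

theorem ae_norm_le_of_memLp_top {α E : Type*} [MeasurableSpace α] {μ : Measure α}
    [NormedAddCommGroup E] {f : α → E} (hf : MemLp f ⊤ μ) :
    ∀ᵐ x ∂μ, ‖f x‖ ≤ (eLpNorm f ⊤ μ).toReal := by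
  filter_upwards [ae_le_eLpNormEssSup (f := f) (μ := μ)] with x hx
  rw [← toReal_enorm, eLpNorm_exponent_top]
  refine ENNReal.toReal_mono ?_ hx
  rw [← eLpNorm_exponent_top]
  exact hf.eLpNorm_lt_top.ne

/-- `E` and `F` may differ, so Cauchy-Schwarz is applied to the scalar functions `‖f‖` and `‖g‖` in
real L². -/
theorem integral_norm_mul_norm_le {α E F : Type*} [MeasurableSpace α] {μ : Measure α}
    [NormedAddCommGroup E] [NormedAddCommGroup F] (f : Lp E 2 μ) (g : Lp F 2 μ) :
    ∫ x, ‖f x‖ * ‖g x‖ ∂μ ≤ ‖f‖ * ‖g‖ := by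
  have hf := (Lp.memLp f).norm
  have hg := (Lp.memLp g).norm
  have h := real_inner_le_norm (hf.toLp _) (hg.toLp _)
  rw [Lp.norm_toLp, Lp.norm_toLp, eLpNorm_norm, eLpNorm_norm, ← Lp.norm_def, ← Lp.norm_def,
    L2.inner_def] at h
  refine le_trans (le_of_eq ?_) h
  refine integral_congr_ae ?_
  filter_upwards [hf.coeFn_toLp, hg.coeFn_toLp] with x h1 h2
  rw [h1, h2]
  simp [mul_comm]

theorem BoundedCoercive.exists_abs_energy_le (hA : BoundedCoercive Ω A) :
    ∃ C, ∀ G Φ : Lp (EuclideanSpace ℝ (Fin N)) 2 (vol Ω),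
      |energy Ω A G Φ| ≤ C * ‖G‖ * ‖Φ‖ := by
  set M : Fin N → Fin N → ℝ := fun i j => (eLpNorm (fun x => A x i j) ⊤ (vol Ω)).toReal
  have hM : ∀ i j, 0 ≤ M i j := fun i j => ENNReal.toReal_nonneg
  set C := ∑ i, ∑ j, M i j with hC
  have hall : ∀ᵐ x ∂(vol Ω), ∀ i j, ‖A x i j‖ ≤ M i j :=
    ae_all_iff.2 fun i => ae_all_iff.2 fun j => ae_norm_le_of_memLp_top (hA.bounded i j)
  refine ⟨C, fun G Φ => ?_⟩
  have hi : Integrable (fun x => C * (‖G x‖ * ‖Φ x‖)) (vol Ω) :=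
    ((Lp.memLp G).norm.integrable_mul (Lp.memLp Φ).norm).const_mul C
  calc |energy Ω A G Φ| ≤ ∫ x in Ω, C * (‖G x‖ * ‖Φ x‖) := by
        rw [← Real.norm_eq_abs, energy]
        refine norm_integral_le_of_norm_le hi ?_
        filter_upwards [hall] with x hx
        rw [hC, Finset.sum_mul]
        refine (norm_sum_le _ _).trans (Finset.sum_le_sum fun i _ => ?_)
        rw [norm_mul, Finset.sum_mul]
        have hrow : ‖(A x *ᵥ (G x).ofLp) i‖ ≤ ∑ j, ‖A x i j * (G x).ofLp j‖ :=
          norm_sum_le Finset.univ fun j => A x i j * (G x).ofLp j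
        refine (mul_le_mul_of_nonneg_left hrow (norm_nonneg _)).trans ?_
        rw [Finset.mul_sum]
        refine Finset.sum_le_sum fun j _ => ?_
        rw [norm_mul]
        calc ‖(Φ x).ofLp i‖ * (‖A x i j‖ * ‖(G x).ofLp j‖)
            ≤ ‖Φ x‖ * (M i j * ‖G x‖) := by
              gcongr
              · exact PiLp.norm_apply_le _ _
              · exact hx i j
              · exact PiLp.norm_apply_le _ _
          _ = M i j * (‖G x‖ * ‖Φ x‖) := by ring
    _ ≤ C * ‖G‖ * ‖Φ‖ := by
        rw [integral_const_mul, mul_assoc]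
        exact mul_le_mul_of_nonneg_left (integral_norm_mul_norm_le G Φ)
          (Finset.sum_nonneg fun i _ => Finset.sum_nonneg fun j _ => hM i j)

theorem BoundedCoercive.exists_energyForm (hA : BoundedCoercive Ω A) :
    ∃ a : Lp (EuclideanSpace ℝ (Fin N)) 2 (vol Ω) →L[ℝ]
        Lp (EuclideanSpace ℝ (Fin N)) 2 (vol Ω) →L[ℝ] ℝ,
      ∀ G Φ, a G Φ = energy Ω A G Φ := by
  obtain ⟨C, hC⟩ := hA.exists_abs_energy_le
  refine ⟨LinearMap.mkContinuous₂ (LinearMap.mk₂ ℝ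
    (fun G Φ : Lp (EuclideanSpace ℝ (Fin N)) 2 (vol Ω) => energy Ω A G Φ) ?_ ?_ ?_ ?_) C hC,
    fun G Φ => rfl⟩
  · intro G G' Φ
    rw [← hA.energy_add_left (Lp.memLp G) (Lp.memLp G') (Lp.memLp Φ)]
    exact energy_congr (Lp.coeFn_add G G') (ae_eq_refl _)
  · intro c G Φ
    rw [smul_eq_mul, ← energy_smul_left]
    exact energy_congr (Lp.coeFn_smul c G) (ae_eq_refl _)
  · intro G Φ Φ'
    rw [← hA.energy_add_right (Lp.memLp G) (Lp.memLp Φ) (Lp.memLp Φ')]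
    exact energy_congr (ae_eq_refl _) (Lp.coeFn_add Φ Φ')
  · intro c G Φ
    rw [smul_eq_mul, ← energy_smul_right]
    exact energy_congr (ae_eq_refl _) (Lp.coeFn_smul c Φ)

theorem BoundedCoercive.exists_mul_norm_sq_le_energy (hA : BoundedCoercive Ω A) :
    ∃ α : ℝ, 0 < α ∧ ∀ G : Lp (EuclideanSpace ℝ (Fin N)) 2 (vol Ω),
      α * ‖G‖ ^ 2 ≤ energy Ω A G G := by
  obtain ⟨α, hα, h⟩ := hA.coercive
  refine ⟨α, hα, fun G => ?_⟩
  have h1 : ‖G‖ ^ 2 = ∫ x in Ω, ‖G x‖ ^ 2 := by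
    rw [← real_inner_self_eq_norm_sq, L2.inner_def]
    simp only [real_inner_self_eq_norm_sq]
  rw [h1, ← integral_const_mul]
  refine integral_mono_ae ((Lp.memLp G).norm.integrable_sq.const_mul α)
    (hA.integrable (Lp.memLp G) (Lp.memLp G)) ?_
  filter_upwards [h] with x hx using hx _

end Energy

/-! ### Rayleigh quotients and eigenvalues. -/

section FirstEigenvalue

variable {N : ℕ} {Ω : Set (EuclideanSpace ℝ (Fin N))}
  {A : EuclideanSpace ℝ (Fin N) → Matrix (Fin N) (Fin N) ℝ}

/-- The gradient, as an operator on `H¹₀(Ω)`. -/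
noncomputable def sobolevZeroSnd (Ω : Set (EuclideanSpace ℝ (Fin N))) :
    sobolevZero Ω →L[ℝ] Lp (EuclideanSpace ℝ (Fin N)) 2 (vol Ω) :=
  (ContinuousLinearMap.snd ℝ _ _).comp (sobolevZero Ω).subtypeL

theorem norm_sq_le_sobolevZero (u : sobolevZero Ω) :
    ‖u‖ ^ 2 ≤ ‖sobolevZeroSnd Ω u‖ ^ 2 + ‖sobolevZeroFst Ω u‖ ^ 2 := by
  have h3 : ‖u‖ = max ‖sobolevZeroFst Ω u‖ ‖sobolevZeroSnd Ω u‖ := rfl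
  rcases max_choice ‖sobolevZeroFst Ω u‖ ‖sobolevZeroSnd Ω u‖ with h4 | h4 <;> rw [h3, h4]
  · exact le_add_of_nonneg_left (sq_nonneg _)
  · exact le_add_of_nonneg_right (sq_nonneg _)

theorem memH10_sobolevZero (u : sobolevZero Ω) :
    MemH10 Ω (sobolevZeroFst Ω u) (sobolevZeroSnd Ω u) :=
  memH10_of_mem_sobolevZero u.2

theorem MemH10.exists_sobolevZero {w : EuclideanSpace ℝ (Fin N) → ℝ}
    {G : EuclideanSpace ℝ (Fin N) → EuclideanSpace ℝ (Fin N)} (h : MemH10 Ω w G) :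
    ∃ u : sobolevZero Ω, sobolevZeroFst Ω u =ᵐ[vol Ω] w ∧ sobolevZeroSnd Ω u =ᵐ[vol Ω] G :=
  ⟨⟨_, h.mem_sobolevZero⟩, h.memH1.memLp.coeFn_toLp, h.memH1.memLp_grad.coeFn_toLp⟩

/-- Adding the L² inner product makes the form coercive for the full H¹ norm without Poincaré's
inequality; it only shifts the eigenvalues by 1. -/
theorem BoundedCoercive.exists_sobolevForm (hA : BoundedCoercive Ω A) :
    ∃ B : sobolevZero Ω →L[ℝ] sobolevZero Ω →L[ℝ] ℝ, ∀ u v,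
      B u v = energy Ω A (sobolevZeroSnd Ω u) (sobolevZeroSnd Ω v)
        + inner ℝ (sobolevZeroFst Ω u) (sobolevZeroFst Ω v) := by
  obtain ⟨a, ha⟩ := hA.exists_energyForm
  have hbound : ∀ u v : sobolevZero Ω, ‖(innerₗ (Lp ℝ 2 (vol Ω))).compl₁₂
      (sobolevZeroFst Ω).toLinearMap (sobolevZeroFst Ω).toLinearMap u v‖
      ≤ ‖sobolevZeroFst Ω‖ * ‖sobolevZeroFst Ω‖ * ‖u‖ * ‖v‖ := by
    intro u v
    refine (norm_inner_le_norm (𝕜 := ℝ) (sobolevZeroFst Ω u) (sobolevZeroFst Ω v)).trans ?_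
    calc ‖sobolevZeroFst Ω u‖ * ‖sobolevZeroFst Ω v‖
        ≤ (‖sobolevZeroFst Ω‖ * ‖u‖) * (‖sobolevZeroFst Ω‖ * ‖v‖) := by
          gcongr <;> exact ContinuousLinearMap.le_opNorm _ _
      _ = ‖sobolevZeroFst Ω‖ * ‖sobolevZeroFst Ω‖ * ‖u‖ * ‖v‖ := by ring
  refine ⟨a.bilinearComp (sobolevZeroSnd Ω) (sobolevZeroSnd Ω) + LinearMap.mkContinuous₂ _ _ hbound,
    fun u v => ?_⟩
  rw [← ha]
  rfl

theorem norm_sq_eq_integral {f : Lp ℝ 2 (vol Ω)} {w : EuclideanSpace ℝ (Fin N) → ℝ}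
    (h : f =ᵐ[vol Ω] w) : ‖f‖ ^ 2 = ∫ x in Ω, w x ^ 2 := by
  rw [← real_inner_self_eq_norm_sq, L2.inner_def]
  refine integral_congr_ae ?_
  filter_upwards [h] with x hx
  rw [hx, real_inner_self_eq_norm_sq, Real.norm_eq_abs, sq_abs]

theorem inner_eq_integral {f g : Lp ℝ 2 (vol Ω)} {w : EuclideanSpace ℝ (Fin N) → ℝ}
    (h : g =ᵐ[vol Ω] w) : inner ℝ f g = ∫ x in Ω, f x * w x := by
  rw [L2.inner_def]
  refine integral_congr_ae ?_
  filter_upwards [h] with x hx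
  rw [hx]
  simp [mul_comm]

/-- The Rayleigh quotient of a nonzero element of `H¹₀(Ω)` is at least some eigenvalue. -/
theorem exists_eigenvalue_le_of_energy_le (hΩ : MeasurableSet Ω) (hb : Bornology.IsBounded Ω)
    (hA : BoundedCoercive Ω A) {w : EuclideanSpace ℝ (Fin N) → ℝ}
    {G : EuclideanSpace ℝ (Fin N) → EuclideanSpace ℝ (Fin N)} (hw : MemH10 Ω w G)
    (hw0 : ¬ w =ᵐ[vol Ω] 0) {κ : ℝ} (hle : energy Ω A G G ≤ κ * ∫ x in Ω, w x ^ 2) :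
    ∃ μ ≤ κ, IsDirichletEigenvalue Ω (symmPart A) μ := by
  obtain ⟨α, hα, hcoer⟩ := hA.symmPart.exists_mul_norm_sq_le_energy
  obtain ⟨B, hB⟩ := hA.symmPart.exists_sobolevForm
  obtain ⟨p, hp₁, hp₂⟩ := hw.exists_sobolevZero
  have hp0 : sobolevZeroFst Ω p ≠ 0 := fun h =>
    hw0 (hp₁.symm.trans (Lp.eq_zero_iff_ae_eq_zero.1 h))
  have hsymm : ∀ u v, B u v = B v u := fun u v => by
    rw [hB, hB, energy_symmPart_comm, real_inner_comm]
  have hBcoer : ∀ u, min α 1 * ‖u‖ ^ 2 ≤ B u u := fun u => by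
    rw [hB, real_inner_self_eq_norm_sq]
    calc min α 1 * ‖u‖ ^ 2
        ≤ min α 1 * (‖sobolevZeroSnd Ω u‖ ^ 2 + ‖sobolevZeroFst Ω u‖ ^ 2) :=
          mul_le_mul_of_nonneg_left (norm_sq_le_sobolevZero u) (le_min hα.le zero_le_one)
      _ ≤ α * ‖sobolevZeroSnd Ω u‖ ^ 2 + 1 * ‖sobolevZeroFst Ω u‖ ^ 2 := by
          rw [mul_add]
          exact add_le_add (mul_le_mul_of_nonneg_right (min_le_left _ _) (sq_nonneg _))
            (mul_le_mul_of_nonneg_right (min_le_right _ _) (sq_nonneg _))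
      _ ≤ _ := by
          rw [one_mul]
          exact add_le_add (hcoer _) le_rfl
  obtain ⟨u, m, hu0, hm, hu⟩ := exists_rayleigh_minimizer (sobolevZeroFst Ω)
    (isCompactOperator_sobolevZeroFst hΩ hb) B hsymm (lt_min hα one_pos) hBcoer p hp0
  -- The `- 1` undoes the shift by the L² inner product.
  refine ⟨m - 1, ?_, sobolevZeroFst Ω u, sobolevZeroSnd Ω u, memH10_sobolevZero u,
    fun h => hu0 (Lp.eq_zero_iff_ae_eq_zero.2 h), fun φ Dφ hφ => ?_⟩
  · rw [hB, real_inner_self_eq_norm_sq, energy_congr hp₂ hp₂, energy_symmPart_self] at hm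
    rw [← norm_sq_eq_integral hp₁] at hle
    have hpos : 0 < ‖sobolevZeroFst Ω p‖ ^ 2 := pow_pos (norm_pos_iff.2 hp0) 2
    have h : m * ‖sobolevZeroFst Ω p‖ ^ 2 ≤ (κ + 1) * ‖sobolevZeroFst Ω p‖ ^ 2 := by linarith
    linarith [le_of_mul_le_mul_right h hpos]
  · obtain ⟨v, hv₁, hv₂⟩ := hφ.exists_sobolevZero
    have h := hu v
    rw [hB, inner_eq_integral hv₁, energy_congr (ae_eq_refl _) hv₂] at h
    linarith

end FirstEigenvalue

/-! ### Comparison of two solutions. -/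

section Comparison

/-- Moving everything to one side avoids subtraction and lets integrals be compared in [0, ∞]. An
infinite `a` with finite `b` is excluded by the hypothesis. -/
theorem le_add_ofReal_of_ereal_sub_le {a b : ℝ≥0∞} {lam s t : ℝ}
    (h : (a : EReal) - ((lam * s : ℝ) : EReal) ≤ (b : EReal) - ((lam * t : ℝ) : EReal)) :
    a ≤ b + ENNReal.ofReal (lam * (s - t)) := by
  induction b with
  | top => simp
  | coe b =>
    induction a with
    | top =>
      exfalso
      have e : ((b : ℝ≥0∞) : EReal) - ((lam * t : ℝ) : EReal) = (((b : ℝ) - lam * t : ℝ) : EReal) := by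
        push_cast
        rfl
      rw [e, EReal.coe_ennreal_top, EReal.top_sub_coe, top_le_iff] at h
      exact EReal.coe_ne_top _ h
    | coe a =>
      have h' : (a : ℝ) - lam * s ≤ (b : ℝ) - lam * t := by
        have e : ∀ (c : NNReal) (r : ℝ),
            ((c : ℝ≥0∞) : EReal) - ((r : ℝ) : EReal) = (((c : ℝ) - r : ℝ) : EReal) := fun c r => rfl
        rw [e, e] at h
        exact EReal.coe_le_coe_iff.1 h
      rw [← ENNReal.ofReal_coe_nnreal, ← ENNReal.ofReal_coe_nnreal (p := b)]
      refine (ENNReal.ofReal_le_ofReal ?_).trans ENNReal.ofReal_add_le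
      linarith

variable {N : ℕ} {Ω : Set (EuclideanSpace ℝ (Fin N))}
  {A : EuclideanSpace ℝ (Fin N) → Matrix (Fin N) (Fin N) ℝ}
  {F : EuclideanSpace ℝ (Fin N) → ℝ → ℝ≥0∞} {u₁ u₂ : EuclideanSpace ℝ (Fin N) → ℝ}

theorem IsSolution.ae_le (hΩ : MeasurableSet Ω) (hb : Bornology.IsBounded Ω)
    (hA : BoundedCoercive Ω A) (hF : AlmostNonincreasing Ω A F)
    (hu₁ : IsSolution Ω A F u₁) (hu₂ : IsSolution Ω A F u₂) : ∀ᵐ x ∂(vol Ω), u₁ x ≤ u₂ x := by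
  obtain ⟨lam, hlam, hlt, hmono⟩ := hF
  obtain ⟨G₁, h₁, -, hs₁⟩ := hu₁
  obtain ⟨G₂, h₂, hp₂, hs₂⟩ := hu₂
  have hw := (h₁.sub h₂).posPart
  set w : EuclideanSpace ℝ (Fin N) → ℝ := fun x => max ((u₁ - u₂) x) 0 with hwdef
  set G : EuclideanSpace ℝ (Fin N) → EuclideanSpace ℝ (Fin N) :=
    fun x => (Ioi (0 : ℝ)).indicator (1 : ℝ → ℝ) ((u₁ - u₂) x) • (G₁ - G₂) x with hGdef
  have hw0 : ∀ x, 0 ≤ w x := fun x => le_max_right _ _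
  obtain ⟨hf₁, he₁⟩ := hs₁ w G hw (Eventually.of_forall hw0)
  obtain ⟨hf₂, he₂⟩ := hs₂ w G hw (Eventually.of_forall hw0)
  -- Where `u₁ > u₂`, `G` is `G₁ - G₂`; elsewhere the second argument is zero, so the first may be
  -- replaced freely.
  have hE : energy Ω A G G = energy Ω A G₁ G - energy Ω A G₂ G := by
    rw [← hA.energy_sub_left h₁.memH1.memLp_grad h₂.memH1.memLp_grad hw.memH1.memLp_grad]
    refine integral_congr_ae (Eventually.of_forall fun x => ?_)
    by_cases hx : (u₁ - u₂) x ∈ Ioi (0 : ℝ)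
    · simp only [hGdef, indicator_of_mem hx, Pi.one_apply, one_smul]
    · simp only [hGdef, indicator_of_notMem hx, zero_smul, WithLp.ofLp_zero, zero_dotProduct]
  have hint : Integrable (fun x => lam * w x ^ 2) (vol Ω) :=
    hw.memH1.memLp.integrable_sq.const_mul lam
  have hle : ∫⁻ x in Ω, F x (u₁ x) * ENNReal.ofReal (w x)
      ≤ (∫⁻ x in Ω, F x (u₂ x) * ENNReal.ofReal (w x))
        + ENNReal.ofReal (lam * ∫ x in Ω, w x ^ 2) := by
    -- The integral of the sum is split using measurability of the term λw² alone, so none is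
    -- required of `F x (u₂ x)`.
    rw [← integral_const_mul, ofReal_integral_eq_lintegral_ofReal hint
      (Eventually.of_forall fun x => by positivity),
      ← lintegral_add_right' _ hint.1.aemeasurable.ennreal_ofReal]
    refine lintegral_mono_ae ?_
    filter_upwards [hmono, hp₂] with x hx hx₂
    rcases le_total (u₁ x) (u₂ x) with h | h
    · have : w x = 0 := max_eq_right (sub_nonpos.2 h)
      simp [this]
    · have hwx : w x = u₁ x - u₂ x := max_eq_left (sub_nonneg.2 h)
      have h3 := le_add_ofReal_of_ereal_sub_le (hx (u₁ x) (u₂ x) hx₂ h)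
      rw [← hwx] at h3
      calc F x (u₁ x) * ENNReal.ofReal (w x)
          ≤ (F x (u₂ x) + ENNReal.ofReal (lam * w x)) * ENNReal.ofReal (w x) := by gcongr
        _ = _ := by
          rw [add_mul, ← ENNReal.ofReal_mul (mul_nonneg hlam (hw0 x)), mul_assoc, ← sq]
  have hle' := ENNReal.toReal_mono (ENNReal.add_ne_top.2 ⟨hf₂.ne, ENNReal.ofReal_ne_top⟩) hle
  rw [ENNReal.toReal_add hf₂.ne ENNReal.ofReal_ne_top, ENNReal.toReal_ofReal
    (mul_nonneg hlam (integral_nonneg fun x => sq_nonneg (w x))), ← he₁, ← he₂] at hle'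
  by_contra hne
  -- If `u₁ ≤ u₂` fails, w is nonzero with Rayleigh quotient at most λ, which produces an eigenvalue
  -- below λ₁.
  obtain ⟨μ, hμ, heig⟩ := exists_eigenvalue_le_of_energy_le hΩ hb hA hw (fun h => hne (by
    filter_upwards [h] with x hx
    have h4 : (u₁ - u₂) x ≤ w x := le_max_left _ _
    rw [hx, Pi.zero_apply, Pi.sub_apply] at h4
    linarith)) (κ := lam) (by linarith)
  have h5 : firstEigenvalue Ω (symmPart A) ≤ (μ : EReal) := sInf_le ⟨μ, heig, rfl⟩
  exact absurd (hlt.trans_le (h5.trans (EReal.coe_le_coe_iff.2 hμ))) (lt_irrefl _)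

end Comparison

end SingularDirichlet

theorem theorem4p4 (N : ℕ) (hN : 1 ≤ N)
    (Ω : Set (EuclideanSpace ℝ (Fin N))) (hΩ_open : IsOpen Ω) (hΩ_bdd : Bornology.IsBounded Ω)
    (A : EuclideanSpace ℝ (Fin N) → Matrix (Fin N) (Fin N) ℝ)
    (hA : SingularDirichlet.BoundedCoercive Ω A)
    (F : EuclideanSpace ℝ (Fin N) → ℝ → ℝ≥0∞)
    (hF_car : SingularDirichlet.IsCaratheodory Ω F)
    (hF_growth : SingularDirichlet.SingularGrowth Ω F)
    (hF_mono : SingularDirichlet.AlmostNonincreasing Ω A F)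
    (u₁ u₂ : EuclideanSpace ℝ (Fin N) → ℝ)
    (hu₁ : SingularDirichlet.IsSolution Ω A F u₁)
    (hu₂ : SingularDirichlet.IsSolution Ω A F u₂) :
    u₁ =ᵐ[volume.restrict Ω] u₂ := by
  filter_upwards [hu₁.ae_le hΩ_open.measurableSet hΩ_bdd hA hF_mono hu₂,
    hu₂.ae_le hΩ_open.measurableSet hΩ_bdd hA hF_mono hu₁] with x h₁ h₂
  exact le_antisymm h₁ h₂
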